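/- Let $\mathcal S=\mathcal S(\mathbb R;\mathbb R)$ and $\mathcal S'$ be the real Schwartz functions and tempered distributions, $\mathcal S_{\mathbb C},\mathcal S'_{\mathbb C}$ their complexifications, $\langle\cdot,\cdot\rangle$ the (complex bilinear) dual pairing, and $|\cdot|$ the $L^2$-norms. On the cylinder $\sigma$-algebras let $\mu$ on $\mathcal S'$ be the white noise measure and $\nu$ on $\mathcal S'_{\mathbb C}$ the Bargmann--Segal measure, i.e. the Gaussian probability measures with $$\int_{\mathcal S'} e^{i\langle \xi,x\rangle}\,d\mu(x)=e^{-\frac12|\xi|^2}\ (\xi\in\mathcal S),\qquad \int_{\mathcal S'_{\mathbb C}} e^{i\,\Re\langle h,\overline u\rangle}\,d\nu(u)=e^{-\frac14\langle h,\overline h\rangle}\ (h\in\mathcal S_{\mathbb C}).$$ Write $L^2(\mu)=L^2(\mathcal S',\mu;\mathbb C)$ and let $F=\sum_{n\ge0}\langle F^{(n)},:\!\cdot^{\otimes n}\!:\rangle$ be the Wiener--Itô chaos decomposition of $F\in L^2(\mu)$, with symmetric complex kernels $F^{(n)}\in L^2(\mathbb R^n)$, so that $\|F\|^2_{L^2(\mu)}=\sum_n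 n!\,|F^{(n)}|^2$. For $\alpha\ge0$ let $\mathcal D^{\alpha,2}$ (Malliavin--Watanabe--Sobolev space) be the set of those $F\in L^2(\mu)$ for which $(I+N^{\alpha/2})F:=\sum_{n}(1+n^{\alpha/2})\langle F^{(n)},:\!\cdot^{\otimes n}\!:\rangle$ converges in $L^2(\mu)$. The $S$-transform of $F\in L^2(\mu)$ is $SF(h)=\int_{\mathcal S'}\exp\big(\langle h,x\rangle-\tfrac12\langle h,h\rangle\big)F(x)\,d\mu(x)$ for $h\in\mathcal S_{\mathbb C}$. A function $U$ on $\mathcal S_{\mathbb C}$ is said to extend to $H\in L^2(\nu)$ if there are symmetric complex kernels $g^{(n)}\in L^2(\mathbb R^n)$ with $U(h)=\sum_n\langle g^{(n)},h^{\otimes n}\rangle$ for all $h\in\mathcal S_{\mathbb C}$ and $H=\sum_n\langle g^{(n)},\cdot^{\otimes n}\rangle$ in $L^2(\nu)$; here $f\mapsto\langle f,\cdot^{\otimes n}\rangle\in L^2(\nu)$ is the linear $L^2$-continuous extension, to all symmetric kernels $f$, of $h^{\otimes n}\mapsto\langle h,\cdot\rangle^n$. **Theorem.** Let $F\in L^2(\mu)$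 and $m\in\mathbb N=\{0,1,2,\dots\}$. For every $0<\lambda<1$ the function $h\mapsto SF(\lambda h)$ on $\mathcal S_{\mathbb C}$ extends to a unique element $u\mapsto SF(\lambda u)$ of $L^2(\nu)$; the function $\lambda\mapsto\int_{\mathcal S'_{\mathbb C}}|SF(\lambda u)|^2\,d\nu(u)$ is infinitely differentiable on $(0,1)$; and $$F\in\mathcal D^{m,2}\iff \sup_{0<\lambda<1}\partial_\lambda^m\left(\int_{\mathcal S'_{\mathbb C}}|SF(\lambda u)|^2\,d\nu(u)\right)<\infty .$$ -/

import Mathlib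

open MeasureTheory Complex
open scoped SchwartzMap ENNReal ContDiff

noncomputable section

namespace WhiteNoise

/-! ### Schwartz functions, tempered distributions and the cylinder σ-algebra -/

/-- Composition `T ∘ f` of a Schwartz function with a real-linear map between its values. -/
def postcomp {E F : Type*} [NormedAddCommGroup E] [NormedSpace ℝ E]
    [NormedAddCommGroup F] [NormedSpace ℝ F] (T : E →L[ℝ] F) : 𝓢(ℝ, E) →L[ℝ] 𝓢(ℝ, F) :=
  SchwartzMap.bilinLeftCLM ((ContinuousLinearMap.lsmul ℝ ℝ).flip ∘L T)
    (Function.HasTemperateGrowth.const (1 : ℝ))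

theorem postcomp_apply {E F : Type*} [NormedAddCommGroup E] [NormedSpace ℝ E]
    [NormedAddCommGroup F] [NormedSpace ℝ F] (T : E →L[ℝ] F) (f : 𝓢(ℝ, E)) (t : ℝ) :
    postcomp T f t = T (f t) := by
  simp [postcomp, SchwartzMap.bilinLeftCLM_apply]

/-- The real Schwartz space. -/
abbrev RealSchwartz : Type := 𝓢(ℝ, ℝ)

/-- The complexified Schwartz space. -/
abbrev ComplexSchwartz : Type := 𝓢(ℝ, ℂ)

/-- The space `𝒮'` of real tempered distributions. -/
abbrev RealTempered : Type := 𝓢(ℝ, ℝ) →L[ℝ] ℝ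

/-- The complexification `𝒮'_ℂ`: complex tempered distributions. -/
abbrev ComplexTempered : Type := 𝓢(ℝ, ℂ) →L[ℂ] ℂ

/-- The σ-algebra on `𝒮'` generated by the cylinder sets. -/
instance : MeasurableSpace RealTempered :=
  ⨆ ξ : RealSchwartz, MeasurableSpace.comap (fun x : RealTempered => x ξ) inferInstance

/-- The σ-algebra on `𝒮'_ℂ` generated by the cylinder sets. -/
instance : MeasurableSpace ComplexTempered :=
  ⨆ h : ComplexSchwartz, MeasurableSpace.comap (fun u : ComplexTempered => u h) inferInstance

/-- The complex-bilinear extension `⟨h, x⟩` of the dual pairing to `h ∈ 𝒮_ℂ`, for `x ∈ 𝒮'`. -/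
def pair (h : ComplexSchwartz) (x : RealTempered) : ℂ :=
  (x (postcomp reCLM h) : ℂ) + I * (x (postcomp imCLM h) : ℂ)

/-- The bilinear form `⟨h, g⟩ = ∫ h g dt` on `𝒮_ℂ` (no complex conjugation). -/
def bil (h g : ComplexSchwartz) : ℂ := ∫ t : ℝ, h t * g t

/-- The pointwise complex conjugate of a Schwartz function. -/
def conjS (h : ComplexSchwartz) : ComplexSchwartz :=
  postcomp (conjCLE : ℂ →L[ℝ] ℂ) h

/-- The pairing `⟨h, ū⟩` with the conjugate distribution `ū`, that is the complex conjugate of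
`⟨h̄, u⟩`. -/
def pairConj (h : ComplexSchwartz) (u : ComplexTempered) : ℂ :=
  (starRingEnd ℂ) (u (conjS h))

/-! ### The Gaussian measures -/

/-- `μ` is the standard Gaussian (white noise) measure on `𝒮'`, determined by its
characteristic function. -/
structure IsWhiteNoise (μ : Measure RealTempered) : Prop where
  prob : IsProbabilityMeasure μ
  charFun : ∀ ξ : RealSchwartz,
    ∫ x, cexp (I * (x ξ : ℂ)) ∂μ = cexp (-(1 / 2 : ℂ) * ((∫ t : ℝ, ξ t ^ 2 : ℝ) : ℂ))

/-- `ν` is the Gaussian (Bargmann--Segal) measure on `𝒮'_ℂ`, determined by its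
characteristic function. -/
structure IsBargmannSegal (ν : Measure ComplexTempered) : Prop where
  prob : IsProbabilityMeasure ν
  charFun : ∀ h : ComplexSchwartz,
    ∫ u, cexp (I * ((pairConj h u).re : ℂ)) ∂ν = cexp (-(1 / 4 : ℂ) * bil h (conjS h))

/-! ### Kernels, Wick powers and the chaos decomposition -/

/-- The complex Hilbert space `L²(ℝⁿ, dx)_ℂ`. -/
abbrev Kernel (n : ℕ) : Type := Lp ℂ 2 (volume : Measure (Fin n → ℝ))

/-- A kernel is symmetric in its `n` variables. -/
def IsSymmKernel {n : ℕ} (f : Kernel n) : Prop :=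
  ∀ σ : Equiv.Perm (Fin n), (fun t : Fin n → ℝ => f (fun i => t (σ i))) =ᵐ[volume] f

/-- The tensor power `h^{⊗n}` as a function on `ℝⁿ`. -/
def tensorPow (n : ℕ) (h : ComplexSchwartz) (t : Fin n → ℝ) : ℂ := ∏ i, h (t i)

/-- The Wick power `⟨h^{⊗n}, :x^{⊗n}:⟩`, a Hermite polynomial of degree `n` in `⟨h, x⟩`; its
exponential generating function in `n` is the Wick exponential. -/
def wickPow (n : ℕ) (h : ComplexSchwartz) (x : RealTempered) : ℂ :=
  ∑ k ∈ Finset.range (n / 2 + 1),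
    ((n.factorial : ℂ) / ((k.factorial : ℂ) * ((n - 2 * k).factorial : ℂ))) *
      (-(1 / 2 : ℂ) * bil h h) ^ k * pair h x ^ (n - 2 * k)

/-- The graph of `f ↦ ⟨f, :·^{⊗n}:⟩` (the `n`-fold multiple Wiener integral), the linear and
`L²`-continuous extension to all symmetric kernels of `h^{⊗n} ↦ ⟨h^{⊗n}, :·^{⊗n}:⟩`. On the span
of the tensor powers, which is dense in the symmetric kernels, this map is `√n!` times an isometry,
so its extension has the closure of its graph as graph. -/
def wienerGraph (μ : Measure RealTempered) (n : ℕ) : Submodule ℂ (Kernel n × Lp ℂ 2 μ) :=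
  (Submodule.span ℂ {p : Kernel n × Lp ℂ 2 μ | ∃ h : ComplexSchwartz,
    p.1 =ᵐ[volume] tensorPow n h ∧ p.2 =ᵐ[μ] wickPow n h}).topologicalClosure

/-- A sequence of kernels, one for every order; it stands for the formal chaos series
`∑ₙ ⟨Φ⁽ⁿ⁾, :·^{⊗n}:⟩`. -/
abbrev KernelSeq : Type := ∀ n : ℕ, Kernel n

/-- `F = ∑ₙ ⟨Φ⁽ⁿ⁾, :·^{⊗n}:⟩` in `L²(μ)`: the Wiener--Itô chaos decomposition of `F`. -/
def HasChaosExpansion (μ : Measure RealTempered) (F : Lp ℂ 2 μ) (Φ : KernelSeq) : Prop :=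
  (∀ n, IsSymmKernel (Φ n)) ∧
    ∃ W : ℕ → Lp ℂ 2 μ, (∀ n, (Φ n, W n) ∈ wienerGraph μ n) ∧ HasSum W F

/-- The space `𝒢_s`. -/
def Gspace (s : ℝ) : Set KernelSeq :=
  {Φ | (∀ n, IsSymmKernel (Φ n)) ∧
    Summable fun n : ℕ => (2 : ℝ) ^ (2 * s * n) * (n.factorial : ℝ) * ‖Φ n‖ ^ 2}

/-- The space `𝒢'` of regular generalized functions. -/
def Gdual : Set KernelSeq := ⋃ q : ℕ, Gspace (-(q : ℝ))

/-- The Malliavin--Watanabe--Sobolev space `𝒟^{α,2}`: those `Φ ∈ 𝒢'` for which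
`(I + N^{α/2}) Φ = ∑ₙ (1 + n^{α/2}) ⟨Φ⁽ⁿ⁾, :·^{⊗n}:⟩` converges in `L²(μ)`. -/
def malliavinSobolev (μ : Measure RealTempered) (α : ℝ) : Set KernelSeq :=
  {Φ | Φ ∈ Gdual ∧ ∃ W : ℕ → Lp ℂ 2 μ, (∀ n, (Φ n, W n) ∈ wienerGraph μ n) ∧
    Summable fun n : ℕ => ((1 + (n : ℝ) ^ (α / 2) : ℝ) : ℂ) • W n}

/-- Membership `F ∈ 𝒟^{α,2}` of `F ∈ L²(μ)`, regarded as an element of `𝒢'` through its chaos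
decomposition. -/
def MemMalliavinSobolev (μ : Measure RealTempered) (α : ℝ) (F : Lp ℂ 2 μ) : Prop :=
  ∃ Φ : KernelSeq, HasChaosExpansion μ F Φ ∧ Φ ∈ malliavinSobolev μ α

/-! ### The `S`-transform and the Bargmann--Segal norm -/

/-- The Wick exponential `:exp⟨h, ·⟩:`. -/
def wickExp (h : ComplexSchwartz) (x : RealTempered) : ℂ :=
  cexp (pair h x - (1 / 2 : ℂ) * bil h h)

/-- The `S`-transform of `F ∈ L²(μ)`. -/
def sTransform (μ : Measure RealTempered) (F : Lp ℂ 2 μ) (h : ComplexSchwartz) : ℂ :=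
  ∫ x, wickExp h x * F x ∂μ

/-- The graph of `f ↦ ⟨f, ·^{⊗n}⟩ ∈ L²(ν)`, the linear and `L²`-continuous extension to all
symmetric kernels of `h^{⊗n} ↦ ⟨h, ·⟩ⁿ`, which again is `√n!` times an isometry. -/
def monomialGraph (ν : Measure ComplexTempered) (n : ℕ) :
    Submodule ℂ (Kernel n × Lp ℂ 2 ν) :=
  (Submodule.span ℂ {p : Kernel n × Lp ℂ 2 ν | ∃ h : ComplexSchwartz,
    p.1 =ᵐ[volume] tensorPow n h ∧ p.2 =ᵐ[ν] fun u => u h ^ n}).topologicalClosure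

/-- `H ∈ E²(ν)` is the extension to `𝒮'_ℂ` (`ν`-almost everywhere) of the function `U` on `𝒮_ℂ`:
for some symmetric kernels `g⁽ⁿ⁾` one has `U(h) = ∑ₙ ⟨g⁽ⁿ⁾, h^{⊗n}⟩` for all `h ∈ 𝒮_ℂ`, and
`H = ∑ₙ ⟨g⁽ⁿ⁾, ·^{⊗n}⟩` in `L²(ν)`. -/
def IsBSExtension (ν : Measure ComplexTempered) (U : ComplexSchwartz → ℂ) (H : Lp ℂ 2 ν) : Prop :=
  ∃ g : KernelSeq, (∀ n, IsSymmKernel (g n)) ∧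
    (∀ h : ComplexSchwartz,
      HasSum (fun n : ℕ => ∫ t : Fin n → ℝ, g n t * tensorPow n h t) (U h)) ∧
    ∃ M : ℕ → Lp ℂ 2 ν, (∀ n, (g n, M n) ∈ monomialGraph ν n) ∧ HasSum M H

open Classical in
/-- The extension of `U` to `𝒮'_ℂ`, where it exists (and `0` otherwise). -/
def bsExtension (ν : Measure ComplexTempered) (U : ComplexSchwartz → ℂ) : Lp ℂ 2 ν :=
  if hU : ∃ H : Lp ℂ 2 ν, IsBSExtension ν U H then hU.choose else 0

/-- The function `𝒮_ℂ ∋ h ↦ SF(λ h)`. -/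
def scaledS (μ : Measure RealTempered) (F : Lp ℂ 2 μ) (l : ℝ) (h : ComplexSchwartz) : ℂ :=
  sTransform μ F ((l : ℂ) • h)

/-- The function `λ ↦ ∫ |SF(λ u)|² dν(u)`. -/
def bsNormSq (μ : Measure RealTempered) (ν : Measure ComplexTempered) (F : Lp ℂ 2 μ) (l : ℝ) : ℝ :=
  ∫ u, ‖bsExtension ν (scaledS μ F l) u‖ ^ 2 ∂ν

end WhiteNoise

end

/-! Write `F = ∑ wₙ` with `wₙ` in the `n`-th Wiener chaos and kernel `fₙ`. The Wick exponential
generates the Wick powers, so `SF(λh) = ∑ λⁿ ⟨fₙ, h^{⊗n}⟩` (`hasSum_scaledS`). Wick powers under `μ`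
and monomials under `ν` have the same Gram matrix, `n!` times that of the tensor powers. Hence
`SF(λ·)` extends to `L²(ν)` with kernels `λⁿ fₙ`, and its squared norm is `∑ ‖wₙ‖² λ^{2n}`
(`bsNormSq_eq_tsum`). This is an even power series with nonnegative summable coefficients. By
`bddAbove_iteratedDeriv_iff` its `m`-th derivative is bounded on `(0, 1)` exactly when `∑ nᵐ ‖wₙ‖² <
∞`, and by `summable_malliavin_iff` this is the Sobolev condition of order `m`.

The Gaussian input is obtained from the characteristic functions alone. They give exponential
moments and, by comparing power series coefficients, the Laplace transforms
(`IsGaussianPair.integral_cexp`). Comparing coefficients again gives the orthogonality relations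
(`integral_wickPoly_mul_wickPoly`). Uniqueness of characteristic functions on the cylinder σ-algebra
makes the Wick powers total, which yields the chaos decomposition (`exists_chaosExpansion`). -/

noncomputable section

namespace WhiteNoise

/-! ### Power series -/

/-- A power series in a real variable that vanishes identically has vanishing coefficients. -/
theorem coeff_eq_of_forall_hasSum {a b : ℕ → ℂ} {f : ℝ → ℂ}
    (ha : ∀ s : ℝ, HasSum (fun n => (s : ℂ) ^ n * a n) (f s))
    (hb : ∀ s : ℝ, HasSum (fun n => (s : ℂ) ^ n * b n) (f s)) : a = b := by
  have h0 : ∀ s : ℝ, HasSum (fun n => (s : ℂ) ^ n * (a n - b n)) 0 := fun s => by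
    simpa [mul_sub] using (ha s).sub (hb s)
  let p : FormalMultilinearSeries ℝ ℝ ℂ := fun n =>
    ContinuousMultilinearMap.mkPiRing ℝ (Fin n) (a n - b n)
  have hc : ∀ n, p.coeff n = a n - b n := fun n => by
    simp [p, FormalMultilinearSeries.coeff]
  have hp : HasFPowerSeriesAt (0 : ℝ → ℂ) p 0 := by
    rw [hasFPowerSeriesAt_iff]
    refine Filter.Eventually.of_forall fun z => ?_
    simpa [hc] using h0 z
  have hz := hp.eq_zero
  funext n
  have := hc n
  rw [hz] at this
  have h1 : (0 : FormalMultilinearSeries ℝ ℝ ℂ).coeff n = 0 := by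
    simp [FormalMultilinearSeries.coeff]
  rw [h1] at this
  exact (sub_eq_zero.mp this.symm)

/-- The derivatives of an even power series with bounded coefficients. -/
theorem hasDerivAt_tsum_descFactorial {a : ℕ → ℝ} {C : ℝ} (ha : ∀ n, |a n| ≤ C) (k : ℕ)
    {x : ℝ} (hx : x ∈ Set.Ioo (0 : ℝ) 1) :
    HasDerivAt (fun y : ℝ => ∑' n, (((2 * n).descFactorial k : ℕ) : ℝ) * a n * y ^ (2 * n - k))
      (∑' n, (((2 * n).descFactorial (k + 1) : ℕ) : ℝ) * a n * x ^ (2 * n - (k + 1))) x := by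
  obtain ⟨r, hxr, hr1⟩ := exists_between hx.2
  have hr0 : 0 < r := hx.1.trans hxr
  have hC : 0 ≤ C := (abs_nonneg _).trans (ha 0)
  -- Polynomial growth times `r ^ (2n)` with `r < 1` majorizes the terms uniformly in `y < r`. For
  -- `2n < j` the exponent `2n - j` is truncated, but then the falling factorial vanishes.
  have key : ∀ (j n : ℕ) (y : ℝ), y ∈ Set.Ioo 0 r →
      ‖(((2 * n).descFactorial j : ℕ) : ℝ) * a n * y ^ (2 * n - j)‖ ≤
        C * (r ^ j)⁻¹ * (((2 * n : ℕ) : ℝ) ^ j * r ^ (2 * n)) := by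
    intro j n y hy
    rcases lt_or_ge (2 * n) j with h | h
    · rw [Nat.descFactorial_of_lt h]
      simp only [Nat.cast_zero, zero_mul, norm_zero]
      positivity
    · rw [norm_mul, norm_mul, Real.norm_eq_abs, Real.norm_eq_abs, Real.norm_eq_abs, Nat.abs_cast,
        abs_of_pos (pow_pos hy.1 _)]
      have e : r ^ (2 * n) = r ^ j * r ^ (2 * n - j) := by rw [← pow_add]; congr 1; omega
      have h1 : (((2 * n).descFactorial j : ℕ) : ℝ) ≤ ((2 * n : ℕ) : ℝ) ^ j := by
        exact_mod_cast Nat.descFactorial_le_pow (2 * n) j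
      calc _ ≤ ((2 * n : ℕ) : ℝ) ^ j * C * r ^ (2 * n - j) := by
            gcongr
            · exact (pow_pos hy.1 _).le
            · exact ha n
            · exact hy.1.le
            · exact hy.2.le
        _ = _ := by
            rw [e]; field_simp
  have hsum : ∀ j : ℕ, Summable fun n : ℕ =>
      C * (r ^ j)⁻¹ * (((2 * n : ℕ) : ℝ) ^ j * r ^ (2 * n)) := fun j =>
    ((summable_pow_mul_geometric_of_norm_lt_one j (r := r)
      (by rwa [Real.norm_eq_abs, abs_of_pos hr0])).comp_injective
        (i := fun n : ℕ => 2 * n) (fun m n h => by simpa using h)).mul_left _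
  refine hasDerivAt_tsum_of_isPreconnected (t := Set.Ioo 0 r) (hsum (k + 1)) isOpen_Ioo
    isPreconnected_Ioo (fun n y hy => ?_) (fun n y hy => key (k + 1) n y hy)
    (y₀ := x) ⟨hx.1, hxr⟩ ((hsum k).of_norm_bounded fun n => key k n x ⟨hx.1, hxr⟩) ⟨hx.1, hxr⟩
  have h := (hasDerivAt_pow (2 * n - k) y).const_mul ((((2 * n).descFactorial k : ℕ) : ℝ) * a n)
  refine h.congr_deriv ?_
  rw [Nat.descFactorial_succ]
  push_cast
  rw [show 2 * n - (k + 1) = 2 * n - k - 1 by omega]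
  ring

/-- The interval is open and derivatives are local, so the values of `f` outside `(0, 1)` do not
matter. -/
theorem iteratedDeriv_tsum_even {a : ℕ → ℝ} {C : ℝ} (ha : ∀ n, |a n| ≤ C) {f : ℝ → ℝ}
    (hf : ∀ x ∈ Set.Ioo (0 : ℝ) 1, f x = ∑' n, a n * x ^ (2 * n)) (k : ℕ) :
    ∀ x ∈ Set.Ioo (0 : ℝ) 1, iteratedDeriv k f x =
      ∑' n, (((2 * n).descFactorial k : ℕ) : ℝ) * a n * x ^ (2 * n - k) := by
  induction k with
  | zero => intro x hx; simpa using hf x hx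
  | succ k ih =>
    intro x hx
    rw [iteratedDeriv_succ]
    refine HasDerivAt.deriv ((hasDerivAt_tsum_descFactorial ha k hx).congr_of_eventuallyEq ?_)
    filter_upwards [isOpen_Ioo.mem_nhds hx] with y hy using ih y hy

theorem contDiffOn_tsum_even {a : ℕ → ℝ} {C : ℝ} (ha : ∀ n, |a n| ≤ C) {f : ℝ → ℝ}
    (hf : ∀ x ∈ Set.Ioo (0 : ℝ) 1, f x = ∑' n, a n * x ^ (2 * n)) :
    ContDiffOn ℝ ∞ f (Set.Ioo 0 1) := by
  refine contDiffOn_of_differentiableOn_deriv fun k _ => ?_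
  have h1 : ∀ x ∈ Set.Ioo (0 : ℝ) 1, iteratedDerivWithin k f (Set.Ioo 0 1) x =
      ∑' n, (((2 * n).descFactorial k : ℕ) : ℝ) * a n * x ^ (2 * n - k) := fun x hx => by
    rw [iteratedDerivWithin_of_isOpen isOpen_Ioo hx, iteratedDeriv_tsum_even ha hf k x hx]
  refine DifferentiableOn.congr (fun x hx => ?_) h1
  exact (hasDerivAt_tsum_descFactorial ha k hx).differentiableAt.differentiableWithinAt

/-- The `k`-th derivative of an even power series with nonnegative summable coefficients `a n` is
bounded on `(0, 1)` if and only if `∑ n ^ k * a n` converges. -/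
theorem bddAbove_iteratedDeriv_iff {a : ℕ → ℝ} (ha0 : ∀ n, 0 ≤ a n) (ha : Summable a)
    {f : ℝ → ℝ} (hf : ∀ x ∈ Set.Ioo (0 : ℝ) 1, f x = ∑' n, a n * x ^ (2 * n)) (k : ℕ) :
    BddAbove ((fun x => iteratedDeriv k f x) '' Set.Ioo (0 : ℝ) 1) ↔
      Summable fun n : ℕ => (n : ℝ) ^ k * a n := by
  have hC : ∀ n, |a n| ≤ ∑' i, a i := fun n => by
    rw [abs_of_nonneg (ha0 n)]; exact ha.le_tsum n fun i _ => ha0 i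
  have hd := iteratedDeriv_tsum_even hC hf k
  have hnn : ∀ (n : ℕ), 0 ≤ (((2 * n).descFactorial k : ℕ) : ℝ) * a n := fun n =>
    mul_nonneg (Nat.cast_nonneg _) (ha0 n)
  have hiff : (Summable fun n : ℕ => (n : ℝ) ^ k * a n) ↔
      Summable fun n : ℕ => (((2 * n).descFactorial k : ℕ) : ℝ) * a n := by
    constructor
    · intro h
      refine Summable.of_nonneg_of_le hnn (fun n => ?_) (h.mul_left (2 ^ k))
      rw [← mul_assoc, ← mul_pow]
      refine mul_le_mul_of_nonneg_right ?_ (ha0 n)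
      exact_mod_cast Nat.descFactorial_le_pow (2 * n) k
    · intro h
      -- The falling factorial `(2n)(2n-1)⋯` may vanish for small `n`. From index `k` on, each of
      -- its `k` factors is at least `n`.
      rw [← summable_nat_add_iff k] at h ⊢
      refine Summable.of_nonneg_of_le (fun n => mul_nonneg (by positivity) (ha0 _)) (fun n => ?_) h
      refine mul_le_mul_of_nonneg_right ?_ (ha0 _)
      have h1 := Nat.pow_sub_le_descFactorial (2 * (n + k)) k
      have h2 : (n + k) ^ k ≤ (2 * (n + k) + 1 - k) ^ k := Nat.pow_le_pow_left (by omega) k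
      exact_mod_cast h2.trans h1
  have hsx : ∀ x ∈ Set.Ioo (0 : ℝ) 1, Summable fun n =>
      (((2 * n).descFactorial k : ℕ) : ℝ) * a n * x ^ (2 * n - k) := by
    intro x hx
    have hs : Summable fun n : ℕ =>
      (∑' i, a i) * (x ^ k)⁻¹ * (((2 * n : ℕ) : ℝ) ^ k * x ^ (2 * n)) :=
      ((summable_pow_mul_geometric_of_norm_lt_one k (r := x)
      (by rw [Real.norm_eq_abs, abs_of_pos hx.1]; exact hx.2)).comp_injective
        (i := fun n : ℕ => 2 * n) (fun m n h => by simpa using h)).mul_left _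
    refine Summable.of_nonneg_of_le (fun n => mul_nonneg (hnn n) (pow_nonneg hx.1.le _))
      (fun n => ?_) hs
    have hx0 := hx.1
    rcases lt_or_ge (2 * n) k with h | h
    · rw [Nat.descFactorial_of_lt h]
      have : 0 ≤ ∑' i, a i := tsum_nonneg ha0
      simp only [Nat.cast_zero, zero_mul]
      positivity
    · have e : x ^ (2 * n) = x ^ k * x ^ (2 * n - k) := by rw [← pow_add]; congr 1; omega
      have h1 : (((2 * n).descFactorial k : ℕ) : ℝ) ≤ ((2 * n : ℕ) : ℝ) ^ k := by
        exact_mod_cast Nat.descFactorial_le_pow (2 * n) k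
      calc _ ≤ ((2 * n : ℕ) : ℝ) ^ k * (∑' i, a i) * x ^ (2 * n - k) := by
            gcongr
            · exact ha0 n
            · exact (le_abs_self _).trans (hC n)
        _ = _ := by
            rw [e]; field_simp
  rw [hiff]
  constructor
  · rintro ⟨B, hB⟩
    -- All terms are nonnegative, so each finite partial sum at `x < 1` is at most the derivative,
    -- hence at most `B`. Letting `x → 1` bounds the partial sums of the coefficients.
    refine summable_of_sum_le (c := B) hnn fun s => ?_
    have hcont : Filter.Tendsto (fun x : ℝ => ∑ n ∈ s,
        (((2 * n).descFactorial k : ℕ) : ℝ) * a n * x ^ (2 * n - k)) (nhdsWithin 1 (Set.Iio 1))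
        (nhds (∑ n ∈ s, (((2 * n).descFactorial k : ℕ) : ℝ) * a n)) := by
      have : Continuous (fun x : ℝ => ∑ n ∈ s,
        (((2 * n).descFactorial k : ℕ) : ℝ) * a n * x ^ (2 * n - k)) := by fun_prop
      simpa using (this.tendsto 1).mono_left nhdsWithin_le_nhds
    refine le_of_tendsto hcont ?_
    filter_upwards [Ioo_mem_nhdsLT (show (0 : ℝ) < 1 by norm_num)] with x hx
    refine ((hsx x hx).sum_le_tsum s fun n _ => mul_nonneg (hnn n) (pow_nonneg hx.1.le _)).trans ?_
    rw [← hd x hx]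
    exact hB ⟨x, hx, rfl⟩
  · intro h
    refine ⟨∑' n, (((2 * n).descFactorial k : ℕ) : ℝ) * a n, ?_⟩
    rintro _ ⟨x, hx, rfl⟩
    simp only [hd x hx]
    exact (hsx x hx).tsum_le_tsum (fun n => mul_le_of_le_one_right (hnn n)
      (pow_le_one₀ hx.1.le hx.2.le)) h

/-! ### Orthogonal series and closures of graphs -/

section Hilbert

variable {E E' : Type*} [NormedAddCommGroup E] [InnerProductSpace ℂ E]
  [NormedAddCommGroup E'] [InnerProductSpace ℂ E']

theorem summable_iff_of_pairwise_orthogonal [CompleteSpace E] {v : ℕ → E}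
    (hv : Pairwise fun i j => inner ℂ (v i) (v j) = 0) :
    Summable v ↔ Summable fun n => ‖v n‖ ^ 2 := by
  have hV : OrthogonalFamily ℂ (fun n => Submodule.span ℂ {v n})
      (fun n => (Submodule.span ℂ {v n}).subtypeₗᵢ) := by
    rintro i j hij ⟨x, hx⟩ ⟨y, hy⟩
    obtain ⟨c, rfl⟩ := Submodule.mem_span_singleton.mp hx
    obtain ⟨d, rfl⟩ := Submodule.mem_span_singleton.mp hy
    simp [inner_smul_left, inner_smul_right, hv hij]
  exact hV.summable_iff_norm_sq_summable
    (fun n => ⟨v n, Submodule.mem_span_singleton_self (v n)⟩)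

theorem inner_eq_of_hasSum {v : ℕ → E} {F : E} (hF : HasSum v F) {w : E} {n : ℕ}
    (hv : ∀ j, j ≠ n → inner ℂ w (v j) = 0) : inner ℂ w F = inner ℂ w (v n) :=
  (hF.mapL (innerSL ℂ w)).unique (hasSum_single n hv)

/-- Parseval: pair the series with `F` and use `⟪F, vₙ⟫ = ‖vₙ‖²`. -/
theorem hasSum_norm_sq_of_pairwise_orthogonal {v : ℕ → E} {F : E} (hF : HasSum v F)
    (hv : Pairwise fun i j => inner ℂ (v i) (v j) = 0) :
    HasSum (fun n => ‖v n‖ ^ 2) (‖F‖ ^ 2) := by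
  have h := hF.mapL (innerSL ℂ F)
  have e : ∀ n, inner ℂ F (v n) = ((‖v n‖ ^ 2 : ℝ) : ℂ) := fun n => by
    rw [← inner_conj_symm, inner_eq_of_hasSum hF (fun j hj => hv hj.symm),
      inner_conj_symm, inner_self_eq_norm_sq_to_K]
    simp
  have e' : inner ℂ F F = ((‖F‖ ^ 2 : ℝ) : ℂ) := by
    rw [inner_self_eq_norm_sq_to_K]; simp
  simp only [innerSL_apply_apply, e, e'] at h
  exact_mod_cast h

variable {S : Type*} {T : S → E} {W : S → E'}

/-- The closure of the graph of the linear map determined by `T s ↦ W s`. -/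
def graphClosure (T : S → E) (W : S → E') : Submodule ℂ (E × E') :=
  (Submodule.span ℂ (Set.range fun s => (T s, W s))).topologicalClosure

theorem mem_graphClosure (s : S) : (T s, W s) ∈ graphClosure T W :=
  Submodule.le_topologicalClosure _ (Submodule.subset_span ⟨s, rfl⟩)

/-- A closed linear condition needs checking on the generators only. -/
theorem graphClosure_induction {P : E × E' → Prop} (hP : IsClosed {p | P p})
    (hgen : ∀ s, P (T s, W s)) (h0 : P 0) (hadd : ∀ p q, P p → P q → P (p + q))
    (hsmul : ∀ (c : ℂ) p, P p → P (c • p)) {p : E × E'} (hp : p ∈ graphClosure T W) : P p := by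
  let V : Submodule ℂ (E × E') :=
    { carrier := {p | P p}
      add_mem' := fun {p q} hp hq => hadd p q hp hq
      zero_mem' := h0
      smul_mem' := fun c p hp => hsmul c p hp }
  have : graphClosure T W ≤ V := by
    refine Submodule.topologicalClosure_minimal _ (Submodule.span_le.mpr ?_) hP
    rintro _ ⟨s, rfl⟩
    exact hgen s
  exact this hp

/-- A relation `⟪W s, W' s'⟫ = c * ⟪T s, T' s'⟫` passes to the closures of the graphs. -/
theorem inner_graphClosure {D S' : Type*} [NormedAddCommGroup D] [InnerProductSpace ℂ D]
    {T₁ : S → D} {W₁ : S → E}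
    {c : ℂ} {T₂ : S' → D} {W₂ : S' → E}
    (h : ∀ s s', inner ℂ (W₁ s) (W₂ s') = c * inner ℂ (T₁ s) (T₂ s'))
    {p q : D × E} (hp : p ∈ graphClosure T₁ W₁) (hq : q ∈ graphClosure T₂ W₂) :
    inner ℂ p.2 q.2 = c * inner ℂ p.1 q.1 := by
  have h1 : ∀ s, inner ℂ (W₁ s) q.2 = c * inner ℂ (T₁ s) q.1 := fun s => by
    refine graphClosure_induction (P := fun q : D × E =>
      inner ℂ (W₁ s) q.2 = c * inner ℂ (T₁ s) q.1) ?_ (h s) (by simp) ?_ ?_ hq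
    · exact isClosed_eq (by fun_prop) (by fun_prop)
    · intro p q hp hq
      simp only [Prod.snd_add, Prod.fst_add, inner_add_right, hp, hq]; ring
    · intro d p hp
      simp only [Prod.smul_fst, Prod.smul_snd, inner_smul_right, hp]; ring
  refine graphClosure_induction (P := fun p : D × E =>
      inner ℂ p.2 q.2 = c * inner ℂ p.1 q.1) ?_ h1 (by simp) ?_ ?_ hp
  · exact isClosed_eq (by fun_prop) (by fun_prop)
  · intro p q hp hq
    simp only [Prod.snd_add, Prod.fst_add, inner_add_left, hp, hq]; ring
  · intro d p hp
    simp only [Prod.smul_fst, Prod.smul_snd, inner_smul_left, hp]; ring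

theorem fst_mem_of_mem_graphClosure {p : E × E'} (hp : p ∈ graphClosure T W) :
    p.1 ∈ (Submodule.span ℂ (Set.range T)).topologicalClosure := by
  refine graphClosure_induction (P := fun p : E × E' =>
    p.1 ∈ (Submodule.span ℂ (Set.range T)).topologicalClosure) ?_ (fun s => ?_)
    (Submodule.zero_mem _) (fun p q hp hq => Submodule.add_mem _ hp hq)
    (fun c p hp => Submodule.smul_mem _ c hp) hp
  · exact (Submodule.isClosed_topologicalClosure _).preimage continuous_fst
  · exact Submodule.le_topologicalClosure _ (Submodule.subset_span ⟨s, rfl⟩)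

theorem snd_mem_of_mem_graphClosure {p : E × E'} (hp : p ∈ graphClosure T W) :
    p.2 ∈ (Submodule.span ℂ (Set.range W)).topologicalClosure := by
  refine graphClosure_induction (P := fun p : E × E' =>
    p.2 ∈ (Submodule.span ℂ (Set.range W)).topologicalClosure) ?_ (fun s => ?_)
    (Submodule.zero_mem _) (fun p q hp hq => Submodule.add_mem _ hp hq)
    (fun c p hp => Submodule.smul_mem _ c hp) hp
  · exact (Submodule.isClosed_topologicalClosure _).preimage continuous_snd
  · exact Submodule.le_topologicalClosure _ (Submodule.subset_span ⟨s, rfl⟩)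

theorem norm_sq_graphClosure {c : ℝ} {T : S → E} {W : S → E'}
    (h : ∀ s s', inner ℂ (W s) (W s') = (c : ℂ) * inner ℂ (T s) (T s'))
    {p : E × E'} (hp : p ∈ graphClosure T W) : ‖p.2‖ ^ 2 = c * ‖p.1‖ ^ 2 := by
  have := congrArg re (inner_graphClosure h hp hp)
  rwa [re_ofReal_mul, ← RCLike.re_eq_complex_re, ← norm_sq_eq_re_inner, ← norm_sq_eq_re_inner]
    at this

/-- A continuous linear map that is bounded below on a complete space has closed range. With `f` a
coordinate projection, this shows that every element of the closed span of that coordinate lifts to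
the graph. -/
theorem range_topologicalClosure_le_map [CompleteSpace E] [CompleteSpace E']
    {D : Type*} [NormedAddCommGroup D] [InnerProductSpace ℂ D] (f : E × E' →L[ℂ] D) {K : ℝ}
    (hf : ∀ p ∈ graphClosure T W, ‖p‖ ≤ K * ‖f p‖) :
    (Submodule.span ℂ (Set.range fun s => f (T s, W s))).topologicalClosure ≤
      (graphClosure T W).map (f : E × E' →ₗ[ℂ] D) := by
  have hG : IsClosed (graphClosure T W : Set (E × E')) := Submodule.isClosed_topologicalClosure _
  have : CompleteSpace (graphClosure T W) := hG.completeSpace_coe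
  let g : graphClosure T W →L[ℂ] D := f ∘L (graphClosure T W).subtypeL
  have hg : AntilipschitzWith K.toNNReal g :=
    AddMonoidHomClass.antilipschitz_of_bound g fun x =>
      (hf x x.2).trans (mul_le_mul_of_nonneg_right (Real.le_coe_toNNReal K) (norm_nonneg _))
  have hcl := hg.isClosed_range g.uniformContinuous
  refine Submodule.topologicalClosure_minimal _ (Submodule.span_le.mpr ?_) ?_
  · rintro _ ⟨s, rfl⟩
    exact ⟨_, mem_graphClosure s, rfl⟩
  · convert hcl using 1
    ext x
    constructor
    · rintro ⟨p, hp, rfl⟩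
      exact ⟨⟨p, hp⟩, rfl⟩
    · rintro ⟨⟨p, hp⟩, rfl⟩
      exact ⟨p, hp, rfl⟩

theorem norm_snd_graphClosure {c : ℝ} (hc : 0 < c) {T : S → E} {W : S → E'}
    (h : ∀ s s', inner ℂ (W s) (W s') = (c : ℂ) * inner ℂ (T s) (T s'))
    {p : E × E'} (hp : p ∈ graphClosure T W) : ‖p.2‖ = √c * ‖p.1‖ := by
  rw [← Real.sqrt_sq (norm_nonneg p.2), norm_sq_graphClosure h hp, Real.sqrt_mul hc.le,
    Real.sqrt_sq (norm_nonneg _)]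

theorem exists_mem_graphClosure_of_snd [CompleteSpace E] [CompleteSpace E'] {c : ℝ} (hc : 0 < c)
    {T : S → E} {W : S → E'}
    (h : ∀ s s', inner ℂ (W s) (W s') = (c : ℂ) * inner ℂ (T s) (T s')) {w : E'}
    (hw : w ∈ (Submodule.span ℂ (Set.range W)).topologicalClosure) :
    ∃ k, (k, w) ∈ graphClosure T W := by
  have hsc := Real.sqrt_pos.mpr hc
  obtain ⟨p, hp, rfl⟩ := range_topologicalClosure_le_map (T := T) (W := W)
    -- On the graph `‖p.2‖ = √c ‖p.1‖`, so either coordinate controls the norm of the pair.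
    (ContinuousLinearMap.snd ℂ E E') (K := 1 + (√c)⁻¹) (fun p hp => by
      have := norm_snd_graphClosure hc h hp
      have h1 : ‖p.1‖ = (√c)⁻¹ * ‖p.2‖ := by rw [this]; field_simp
      have h2 : ‖p‖ ≤ ‖p.2‖ + ‖p.1‖ := by
        rw [Prod.norm_def, add_comm]
        exact max_le_add_of_nonneg (norm_nonneg _) (norm_nonneg _)
      simp only [ContinuousLinearMap.coe_snd']
      linarith) hw
  exact ⟨p.1, hp⟩

theorem exists_mem_graphClosure_of_fst [CompleteSpace E] [CompleteSpace E'] {c : ℝ} (hc : 0 < c)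
    {T : S → E} {W : S → E'}
    (h : ∀ s s', inner ℂ (W s) (W s') = (c : ℂ) * inner ℂ (T s) (T s')) {k : E}
    (hk : k ∈ (Submodule.span ℂ (Set.range T)).topologicalClosure) :
    ∃ w, (k, w) ∈ graphClosure T W := by
  obtain ⟨p, hp, rfl⟩ := range_topologicalClosure_le_map (T := T) (W := W)
    (ContinuousLinearMap.fst ℂ E E') (K := 1 + √c) (fun p hp => by
      have h1 := norm_snd_graphClosure hc h hp
      have h2 : ‖p‖ ≤ ‖p.1‖ + ‖p.2‖ := by
        rw [Prod.norm_def]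
        exact max_le_add_of_nonneg (norm_nonneg _) (norm_nonneg _)
      simp only [ContinuousLinearMap.coe_fst']
      linarith) hk
  exact ⟨p.2, hp⟩

/-- An element of the closed span of `T` that is orthogonal to all `T s` vanishes. -/
theorem eq_zero_of_forall_inner_eq_zero {k : E}
    (hk : k ∈ (Submodule.span ℂ (Set.range T)).topologicalClosure)
    (h : ∀ s, inner ℂ (T s) k = 0) : k = 0 := by
  have h1 : (Submodule.span ℂ (Set.range T)).topologicalClosure ≤ (Submodule.span ℂ {k})ᗮ := by
    refine Submodule.topologicalClosure_minimal _ (Submodule.span_le.mpr ?_)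
      (Submodule.isClosed_orthogonal _)
    rintro _ ⟨s, rfl⟩
    rw [SetLike.mem_coe, Submodule.mem_orthogonal_singleton_iff_inner_left]
    exact h s
  exact inner_self_eq_zero.mp (Submodule.mem_orthogonal_singleton_iff_inner_left.mp (h1 hk))

end Hilbert

/-! ### Hermite polynomials and their generating function -/

/-- The Hermite polynomial of degree `n` with variance `q`, evaluated at `z`. -/
def wickPoly (n : ℕ) (q z : ℂ) : ℂ :=
  ∑ k ∈ Finset.range (n / 2 + 1),
    ((n.factorial : ℂ) / ((k.factorial : ℂ) * ((n - 2 * k).factorial : ℂ))) *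
      (-(1 / 2 : ℂ) * q) ^ k * z ^ (n - 2 * k)

theorem wickPow_eq_wickPoly (n : ℕ) (h : ComplexSchwartz) (x : RealTempered) :
    wickPow n h x = wickPoly n (bil h h) (pair h x) := rfl

/-- Through variance zero, the results on Hermite polynomials also cover the monomials of the
Bargmann--Segal side. -/
theorem wickPoly_zero_left (n : ℕ) (z : ℂ) : wickPoly n 0 z = z ^ n := by
  rw [wickPoly, Finset.sum_eq_single 0]
  · simp [Nat.factorial_ne_zero]
  · intro k _ hk
    simp [hk]
  · simp

theorem conj_wickPoly (n : ℕ) (q z : ℂ) :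
    (starRingEnd ℂ) (wickPoly n q z) = wickPoly n ((starRingEnd ℂ) q) ((starRingEnd ℂ) z) := by
  simp [wickPoly, map_ofNat]

/-- This homogeneity turns the generating function into a power series in the scaling parameter `s`.
-/
theorem wickPoly_smul (n : ℕ) (s q z : ℂ) :
    wickPoly n (s ^ 2 * q) (s * z) = s ^ n * wickPoly n q z := by
  rw [wickPoly, wickPoly, Finset.mul_sum]
  refine Finset.sum_congr rfl fun k hk => ?_
  have hk' : 2 * k ≤ n := by have := Finset.mem_range.mp hk; omega
  obtain ⟨j, rfl⟩ := Nat.exists_eq_add_of_le hk'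
  rw [Nat.add_sub_cancel_left, pow_add, pow_mul]
  ring

theorem hasSum_congr_of_eq {E : Type*} [AddCommMonoid E] [TopologicalSpace E] {f g : ℕ → E} {a : E}
    (h : ∀ n, f n = g n) : HasSum f a ↔ HasSum g a := by
  rw [funext h]

/-- The double series is regrouped along `2k + j = n`; the fibre over `n` is indexed by `k ≤ n / 2`.
-/
theorem hasSum_sum_range_two_mul_add {f : ℕ → ℕ → ℂ} {a : ℂ}
    (hf : HasSum (fun p : ℕ × ℕ => f p.1 p.2) a) :
    HasSum (fun n => ∑ k ∈ Finset.range (n / 2 + 1), f k (n - 2 * k)) a := by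
  have h := hf.tsum_fiberwise (fun p : ℕ × ℕ => 2 * p.1 + p.2)
  refine (hasSum_congr_of_eq fun n => ?_).mp h
  have hset : (fun p : ℕ × ℕ => 2 * p.1 + p.2) ⁻¹' {n} =
      ↑((Finset.range (n / 2 + 1)).image fun k => (k, n - 2 * k)) := by
    ext ⟨k, j⟩
    simp only [Set.mem_preimage, Set.mem_singleton_iff, Finset.coe_image, Set.mem_image,
      Finset.coe_range, Set.mem_Iio, Prod.mk.injEq]
    constructor
    · intro h
      exact ⟨k, by omega, rfl, by omega⟩
    · rintro ⟨k, hk, rfl, rfl⟩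
      omega
  rw [hset, Finset.tsum_subtype' _ fun p : ℕ × ℕ => f p.1 p.2, Finset.sum_image (fun a _ b _ h => (Prod.mk.inj h).1)]

theorem hasSum_sum_range_two_mul_add_mul {f g : ℕ → ℂ} {a b : ℂ} (hf : HasSum f a)
    (hg : HasSum g b) :
    HasSum (fun n => ∑ k ∈ Finset.range (n / 2 + 1), f k * g (n - 2 * k)) (a * b) := by
  have h1 : Summable (fun n => ‖f n‖) := hf.summable.norm
  have h2 : Summable (fun n => ‖g n‖) := hg.summable.norm
  have hs : Summable fun p : ℕ × ℕ => f p.1 * g p.2 := summable_mul_of_summable_norm h1 h2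
  have h : HasSum (fun p : ℕ × ℕ => f p.1 * g p.2) (a * b) := hf.mul hg hs
  exact hasSum_sum_range_two_mul_add (f := fun k j => f k * g j) h

theorem hasSum_cexp (w : ℂ) : HasSum (fun n : ℕ => w ^ n / (n.factorial : ℂ)) (cexp w) := by
  rw [Complex.exp_eq_exp_ℂ]
  exact NormedSpace.expSeries_div_hasSum_exp w

/-- The generating function of the Hermite polynomials. -/
theorem hasSum_wickPoly (q z : ℂ) :
    HasSum (fun n : ℕ => wickPoly n q z / (n.factorial : ℂ)) (cexp (z - (1 / 2 : ℂ) * q)) := by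
  have hp := hasSum_sum_range_two_mul_add_mul (hasSum_cexp (-(1 / 2 : ℂ) * q)) (hasSum_cexp z)
  rw [← Complex.exp_add, neg_mul, neg_add_eq_sub] at hp
  refine (hasSum_congr_of_eq fun n => ?_).mp hp
  rw [wickPoly, Finset.sum_div]
  refine Finset.sum_congr rfl fun k _ => ?_
  have h1 : (n.factorial : ℂ) ≠ 0 := Nat.cast_ne_zero.mpr n.factorial_ne_zero
  rw [neg_mul]
  field_simp

/-- A majorant of the Hermite polynomials. -/
def wickBound (n : ℕ) (q z : ℝ) : ℝ :=
  ∑ k ∈ Finset.range (n / 2 + 1),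
    ((n.factorial : ℝ) / ((k.factorial : ℝ) * ((n - 2 * k).factorial : ℝ))) *
      ((1 / 2 : ℝ) * q) ^ k * z ^ (n - 2 * k)

/-- The majorant is the Hermite polynomial of negative variance, so its generating function comes
for free. -/
theorem ofReal_wickBound (n : ℕ) (q z : ℝ) : (wickBound n q z : ℂ) = wickPoly n (-q : ℝ) z := by
  simp [wickBound, wickPoly]

theorem norm_wickPoly_le (n : ℕ) (q z : ℂ) : ‖wickPoly n q z‖ ≤ wickBound n ‖q‖ ‖z‖ := by
  refine (norm_sum_le _ _).trans (le_of_eq (Finset.sum_congr rfl fun k _ => ?_))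
  simp

theorem hasSum_wickBound (q z : ℝ) :
    HasSum (fun n : ℕ => wickBound n q z / (n.factorial : ℝ)) (Real.exp (z + 1 / 2 * q)) := by
  have := hasSum_wickPoly (-q : ℝ) z
  rw [← Complex.hasSum_ofReal]
  convert this using 1
  · funext n
    rw [← ofReal_wickBound, ofReal_div, ofReal_natCast]
  · simp

theorem wickBound_le (n : ℕ) {q z : ℝ} (hq : 0 ≤ q) (hz : 0 ≤ z) :
    wickBound n q z ≤ n.factorial * Real.exp (z + 1 / 2 * q) := by
  have h0 : ∀ n, 0 ≤ wickBound n q z / (n.factorial : ℝ) := fun n => by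
    unfold wickBound; positivity
  have h := le_hasSum (hasSum_wickBound q z) n fun j _ => h0 j
  rwa [div_le_iff₀ (by positivity), mul_comm] at h

/-! ### Random variables with exponential moments -/

section ExpMoments

variable {Ω : Type*} [MeasurableSpace Ω] {P : Measure Ω}

/-- A complex random variable all of whose exponential moments are finite. -/
structure HasExpMoments (P : Measure Ω) (Z : Ω → ℂ) : Prop where
  meas : AEStronglyMeasurable Z P
  integrable_exp : ∀ c : ℝ, Integrable (fun x => Real.exp (c * ‖Z x‖)) P

theorem HasExpMoments.memLp_exp {Z : Ω → ℂ} (hZ : HasExpMoments P Z) (c d : ℝ) :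
    MemLp (fun x => Real.exp (c * ‖Z x‖ + d)) 2 P := by
  have hm : AEStronglyMeasurable (fun x => Real.exp (c * ‖Z x‖ + d)) P :=
    Real.continuous_exp.comp_aestronglyMeasurable ((hZ.meas.norm.const_mul c).add_const d)
  rw [memLp_two_iff_integrable_sq hm]
  refine ((hZ.integrable_exp (2 * c)).const_mul (Real.exp (2 * d))).congr ?_
  refine Filter.Eventually.of_forall fun x => ?_
  simp only
  rw [← Real.exp_add, ← Real.exp_nat_mul]
  congr 1; push_cast; ring

theorem HasExpMoments.memLp_wickPoly {Z : Ω → ℂ} (hZ : HasExpMoments P Z) (n : ℕ) (q : ℂ) :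
    MemLp (fun x => wickPoly n q (Z x)) 2 P := by
  have hc : Continuous (wickPoly n q) := by unfold wickPoly; fun_prop
  refine ((hZ.memLp_exp 1 (1 / 2 * ‖q‖)).const_mul (n.factorial : ℝ)).mono'
    (hc.comp_aestronglyMeasurable hZ.meas) (Filter.Eventually.of_forall fun x => ?_)
  rw [one_mul]
  exact (norm_wickPoly_le _ _ _).trans (wickBound_le n (norm_nonneg _) (norm_nonneg _))

theorem HasExpMoments.memLp_cexp {Z : Ω → ℂ} (hZ : HasExpMoments P Z) (q : ℂ) :
    MemLp (fun x => cexp (Z x - (1 / 2 : ℂ) * q)) 2 P := by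
  refine (hZ.memLp_exp 1 (1 / 2 * ‖q‖)).mono'
    (Complex.continuous_exp.comp_aestronglyMeasurable (hZ.meas.sub aestronglyMeasurable_const))
    (Filter.Eventually.of_forall fun x => ?_)
  rw [Complex.norm_exp]
  refine Real.exp_le_exp.mpr ((re_le_norm _).trans ((norm_sub_le _ _).trans ?_))
  simp

/-- Expansion of the integral of a Wick exponential against a square integrable function. -/
theorem HasExpMoments.hasSum_integral {Z : Ω → ℂ} (hZ : HasExpMoments P Z) (q : ℂ)
    {F : Ω → ℂ} (hF : MemLp F 2 P) :
    HasSum (fun n : ℕ => (∫ x, wickPoly n q (Z x) * F x ∂P) / (n.factorial : ℂ))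
      (∫ x, cexp (Z x - (1 / 2 : ℂ) * q) * F x ∂P) := by
  have hs : ∀ x, HasSum (fun n : ℕ => wickBound n ‖q‖ ‖Z x‖ / (n.factorial : ℝ) * ‖F x‖)
      (Real.exp (‖Z x‖ + 1 / 2 * ‖q‖) * ‖F x‖) := fun x =>
    (hasSum_wickBound _ _).mul_right _
  -- The majorants sum to `exp(‖Z‖ + ‖q‖/2) ‖F‖`, a product of two square integrable functions,
  -- hence integrable.
  have := hasSum_integral_of_dominated_convergence (μ := P)
    (F := fun n x => wickPoly n q (Z x) / (n.factorial : ℂ) * F x)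
    (f := fun x => cexp (Z x - (1 / 2 : ℂ) * q) * F x)
    (fun n x => wickBound n ‖q‖ ‖Z x‖ / (n.factorial : ℝ) * ‖F x‖)
    (fun n => ?_) (fun n => Filter.Eventually.of_forall fun x => ?_)
    (Filter.Eventually.of_forall fun x => (hs x).summable) ?_
    (Filter.Eventually.of_forall fun x => (hasSum_wickPoly q (Z x)).mul_right _)
  · refine (hasSum_congr_of_eq fun n => ?_).mp this
    rw [← integral_div]
    exact integral_congr_ae (Filter.Eventually.of_forall fun x => by ring)
  · simp only [div_eq_mul_inv]
    exact (((hZ.memLp_wickPoly n q).aestronglyMeasurable).mul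
      aestronglyMeasurable_const).mul hF.aestronglyMeasurable
  · rw [norm_mul, norm_div, Complex.norm_natCast]
    gcongr
    exact norm_wickPoly_le _ _ _
  · simp only [fun x => (hs x).tsum_eq]
    have := (hZ.memLp_exp 1 (1 / 2 * ‖q‖)).integrable_mul hF.norm
    simp only [one_mul] at this
    exact this

theorem HasExpMoments.const_mul {Z : Ω → ℂ} (hZ : HasExpMoments P Z) (s : ℂ) :
    HasExpMoments P (fun x => s * Z x) where
  meas := hZ.meas.const_mul s
  integrable_exp c := by
    simpa only [norm_mul, ← mul_assoc] using hZ.integrable_exp (c * ‖s‖)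

theorem HasExpMoments.hasSum_integral_scaled {Z : Ω → ℂ} (hZ : HasExpMoments P Z) (q : ℂ)
    {F : Ω → ℂ} (hF : MemLp F 2 P) (s : ℂ) :
    HasSum (fun n : ℕ => s ^ n * ((∫ x, wickPoly n q (Z x) * F x ∂P) / (n.factorial : ℂ)))
      (∫ x, cexp (s * Z x - (1 / 2 : ℂ) * (s ^ 2 * q)) * F x ∂P) := by
  refine (hasSum_congr_of_eq fun n => ?_).mp ((hZ.const_mul s).hasSum_integral (s ^ 2 * q) hF)
  simp only [wickPoly_smul, mul_assoc, integral_const_mul, mul_div_assoc]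

/-- Orthogonality of the Hermite polynomials, from their generating functions. -/
theorem integral_wickPoly_mul_wickPoly {Z W : Ω → ℂ} (hZ : HasExpMoments P Z)
    (hW : HasExpMoments P W) {q r b : ℂ}
    (h : ∀ s t : ℝ, ∫ x, cexp (s * Z x - (1 / 2 : ℂ) * ((s : ℂ) ^ 2 * q)) *
      cexp (t * W x - (1 / 2 : ℂ) * ((t : ℂ) ^ 2 * r)) ∂P = cexp (s * t * b)) (n m : ℕ) :
    ∫ x, wickPoly n q (Z x) * wickPoly m r (W x) ∂P = if n = m then n.factorial * b ^ n else 0 := by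
  have hfac : ∀ n : ℕ, (n.factorial : ℂ) ≠ 0 := fun n => Nat.cast_ne_zero.mpr n.factorial_ne_zero
  -- Coefficients are compared in `s` with `t` fixed, and afterwards in `t`.
  have h1 : ∀ t : ℝ, ∫ x, wickPoly n q (Z x) *
      cexp (t * W x - (1 / 2 : ℂ) * ((t : ℂ) ^ 2 * r)) ∂P = (t * b) ^ n := by
    intro t
    have hF := (hW.const_mul (t : ℂ)).memLp_cexp ((t : ℂ) ^ 2 * r)
    have := congrFun (coeff_eq_of_forall_hasSum
      (fun s => hZ.hasSum_integral_scaled q hF (s : ℂ))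
      (b := fun n => (t * b) ^ n / (n.factorial : ℂ)) fun s => by
        rw [h s t]
        refine (hasSum_congr_of_eq fun n => ?_).mp (hasSum_cexp (s * t * b))
        rw [mul_assoc, mul_pow, mul_div_assoc]) n
    exact (div_left_inj' (hfac n)).mp this
  have h2 := congrFun (coeff_eq_of_forall_hasSum
      (fun t => hW.hasSum_integral_scaled r (hZ.memLp_wickPoly n q) (t : ℂ))
      (b := fun m => if m = n then b ^ n else 0) fun t => by
        simp only [mul_comm (cexp _)]
        rw [h1 t, mul_pow]
        refine (hasSum_congr_of_eq fun m => ?_).mp (hasSum_ite_eq n ((t : ℂ) ^ n * b ^ n))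
        split_ifs with hm
        · rw [hm]
        · simp) m
  simp only [mul_comm (wickPoly n q _)]
  rw [div_eq_iff (hfac m)] at h2
  rw [h2]
  rcases eq_or_ne n m with rfl | hnm
  · simp [mul_comm]
  · simp [hnm, hnm.symm]

end ExpMoments

/-! ### Gaussian pairs -/

theorem hasSum_of_eq {f g : ℕ → ℂ} {a b : ℂ} (hf : HasSum f a) (h : ∀ n, f n = g n) (hab : a = b) :
    HasSum g b := hab ▸ (hasSum_congr_of_eq h).mp hf

section Gaussian

variable {Ω : Type*} [MeasurableSpace Ω] {P : Measure Ω}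

theorem map_eq_gaussianReal [IsProbabilityMeasure P] {X : Ω → ℝ} (hX : Measurable X) {A : ℝ}
    (hA : 0 ≤ A)
    (h : ∀ a : ℝ, ∫ x, cexp (I * (a * X x : ℝ)) ∂P = cexp (-(1 / 2 : ℂ) * (A * a ^ 2 : ℝ))) :
    P.map X = ProbabilityTheory.gaussianReal 0 A.toNNReal := by
  have : IsProbabilityMeasure (P.map X) := Measure.isProbabilityMeasure_map hX.aemeasurable
  refine Measure.ext_of_charFun (funext fun t => ?_)
  rw [ProbabilityTheory.charFun_gaussianReal, charFun_apply_real,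
    integral_map hX.aemeasurable (by fun_prop)]
  convert h t using 2
  · funext x
    rw [ofReal_mul]; congr 1; ring
  · rw [Real.coe_toNNReal A hA]; push_cast; ring

/-- The law of `X` is Gaussian, and `exp(c|X|) ≤ exp(cX) + exp(-cX)`. -/
theorem integrable_exp_abs_of_charFun [IsProbabilityMeasure P] {X : Ω → ℝ} (hX : Measurable X)
    {A : ℝ} (hA : 0 ≤ A)
    (h : ∀ a : ℝ, ∫ x, cexp (I * (a * X x : ℝ)) ∂P = cexp (-(1 / 2 : ℂ) * (A * a ^ 2 : ℝ)))
    (c : ℝ) : Integrable (fun x => Real.exp (c * |X x|)) P := by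
  have h1 : ∀ t : ℝ, Integrable (fun x => Real.exp (t * X x)) P := fun t => by
    have := ProbabilityTheory.integrable_exp_mul_gaussianReal (μ := 0) (v := A.toNNReal) t
    rw [← map_eq_gaussianReal hX hA h, integrable_map_measure (by fun_prop) hX.aemeasurable] at this
    exact this
  refine ((h1 c).add (h1 (-c))).mono' (by fun_prop) (Filter.Eventually.of_forall fun x => ?_)
  rw [Real.norm_eq_abs, abs_of_pos (Real.exp_pos _), Pi.add_apply]
  rcases abs_cases (X x) with ⟨e, _⟩ | ⟨e, _⟩
  · rw [e]; linarith [Real.exp_pos (-c * X x)]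
  · rw [e, mul_neg, ← neg_mul]; linarith [Real.exp_pos (c * X x)]

theorem hasExpMoments_of_abs {Z : Ω → ℂ} (hZ : AEStronglyMeasurable Z P)
    (hX : ∀ c : ℝ, Integrable (fun x => Real.exp (c * |(Z x).re|)) P)
    (hY : ∀ c : ℝ, Integrable (fun x => Real.exp (c * |(Z x).im|)) P) : HasExpMoments P Z := by
  refine ⟨hZ, fun c => ?_⟩
  refine (((hX (2 * |c|)).add (hY (2 * |c|)))).mono'
    (Real.continuous_exp.comp_aestronglyMeasurable (hZ.norm.const_mul c))
    (Filter.Eventually.of_forall fun x => ?_)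
  rw [Real.norm_eq_abs, abs_of_pos (Real.exp_pos _), Pi.add_apply]
  have h1 : c * ‖Z x‖ ≤ |c| * |(Z x).re| + |c| * |(Z x).im| := by
    rw [← mul_add]
    exact mul_le_mul (le_abs_self c) (norm_le_abs_re_add_abs_im _) (norm_nonneg _) (abs_nonneg _)
  rcases le_total |(Z x).re| |(Z x).im| with h | h
  · refine (Real.exp_le_exp.mpr (h1.trans ?_)).trans (le_add_of_nonneg_left (Real.exp_pos _).le)
    nlinarith [mul_le_mul_of_nonneg_left h (abs_nonneg c)]
  · refine (Real.exp_le_exp.mpr (h1.trans ?_)).trans (le_add_of_nonneg_right (Real.exp_pos _).le)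
    nlinarith [mul_le_mul_of_nonneg_left h (abs_nonneg c)]

/-- The characteristic function of the real and imaginary parts of `Z` is that of a centered
Gaussian pair with covariance matrix `!![A, B; B, C]`. -/
structure IsGaussianPair (P : Measure Ω) (Z : Ω → ℂ) (A B C : ℝ) : Prop where
  meas : Measurable Z
  nonneg_left : 0 ≤ A
  nonneg_right : 0 ≤ C
  charFun : ∀ a b : ℝ, ∫ x, cexp (I * (a * (Z x).re + b * (Z x).im : ℝ)) ∂P =
    cexp (-(1 / 2 : ℂ) * (A * a ^ 2 + 2 * B * (a * b) + C * b ^ 2 : ℝ))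

variable {Z : Ω → ℂ} {A B C : ℝ}

theorem IsGaussianPair.hasExpMoments [IsProbabilityMeasure P] (h : IsGaussianPair P Z A B C) :
    HasExpMoments P Z := by
  refine hasExpMoments_of_abs h.meas.aestronglyMeasurable
    (integrable_exp_abs_of_charFun (measurable_re.comp h.meas) h.nonneg_left fun a => ?_)
    (integrable_exp_abs_of_charFun (measurable_im.comp h.meas) h.nonneg_right fun b => ?_)
  · simpa using h.charFun a 0
  · simpa using h.charFun 0 b

/-- With `Z = X + iY`, the characteristic function gives `E exp(iaX + iY)` for real `a` only, while
`a = -i` is wanted. Both sides are power series in `a` converging everywhere (the right one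
generates Hermite polynomials), so their coefficients agree and the identity continues to `a = -i`.
-/
theorem IsGaussianPair.integral_cexp [IsProbabilityMeasure P] (h : IsGaussianPair P Z A B C) :
    ∫ x, cexp (Z x) ∂P = cexp ((1 / 2 : ℂ) * (A + 2 * I * B - C)) := by
  have hX : HasExpMoments P (fun x => ((Z x).re : ℂ)) := by
    refine hasExpMoments_of_abs (measurable_ofReal.comp
      (measurable_re.comp h.meas)).aestronglyMeasurable ?_ ?_
    · simp only [ofReal_re]
      refine integrable_exp_abs_of_charFun (measurable_re.comp h.meas) h.nonneg_left fun a => ?_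
      simpa using h.charFun a 0
    · simp
  have hF : MemLp (fun x => cexp (I * ((Z x).im : ℂ))) 2 P := by
    refine MemLp.of_bound (Complex.measurable_exp.comp ((measurable_ofReal.comp
      (measurable_im.comp h.meas)).const_mul I)).aestronglyMeasurable 1
      (Filter.Eventually.of_forall fun x => ?_)
    rw [mul_comm, Complex.norm_exp_ofReal_mul_I]
  have hs := hX.hasSum_integral_scaled 0 hF
  have hw : ∀ s : ℂ, HasSum (fun n : ℕ => s ^ n *
      (cexp (-(1 / 2 : ℂ) * C) * (wickPoly n A (-B) / (n.factorial : ℂ))))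
      (cexp (-(1 / 2 : ℂ) * (A * s ^ 2 + 2 * B * s + C))) := fun s => by
    have := (hasSum_wickPoly (s ^ 2 * A) (s * (-B))).mul_left (cexp (-(1 / 2 : ℂ) * C))
    rw [← Complex.exp_add] at this
    refine hasSum_of_eq this (fun n => ?_) ?_
    · rw [wickPoly_smul]; ring
    · congr 1; ring
  have hc := congrFun (coeff_eq_of_forall_hasSum (f := fun a : ℝ =>
      cexp (-(1 / 2 : ℂ) * (A * (a : ℂ) ^ 2 + 2 * B * (a : ℂ) + C)))
    (a := fun n => I ^ n * ((∫ x, wickPoly n 0 ((Z x).re : ℂ) * cexp (I * ((Z x).im : ℂ)) ∂P) /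
      (n.factorial : ℂ)))
    (fun a => by
      have := hs (a * I)
      have e := h.charFun a 1
      refine hasSum_of_eq this (fun n => ?_) ?_
      · rw [mul_pow, mul_assoc]
      · symm
        rw [show -(1 / 2 : ℂ) * (A * (a : ℂ) ^ 2 + 2 * B * (a : ℂ) + C) =
          -(1 / 2 : ℂ) * (A * a ^ 2 + 2 * B * (a * 1) + C * 1 ^ 2 : ℝ) by push_cast; ring, ← e]
        symm
        refine integral_congr_ae (Filter.Eventually.of_forall fun x => ?_)
        simp only
        rw [← Complex.exp_add]
        congr 1; push_cast; ring)
    (fun a => hw a))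
  have h1 : HasSum (fun n : ℕ => (∫ x, wickPoly n 0 ((Z x).re : ℂ) *
      cexp (I * ((Z x).im : ℂ)) ∂P) / (n.factorial : ℂ))
      (cexp (-(1 / 2 : ℂ) * (A * (-I) ^ 2 + 2 * B * (-I) + C))) := by
    refine (hasSum_congr_of_eq fun n => ?_).mp (hw (-I))
    rw [← hc n, ← mul_assoc, ← mul_pow]
    simp
  have h2 := hs 1
  simp only [one_pow, one_mul, mul_zero, sub_zero, ← Complex.exp_add] at h2
  have h3 := h2.unique h1
  convert h3 using 2
  · funext x
    rw [mul_comm I, re_add_im]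
  · rw [neg_sq, I_sq]; ring

end Gaussian

/-! ### The bilinear form on Schwartz functions -/

theorem integrable_mul_schwartz (h g : ComplexSchwartz) :
    Integrable (fun t : ℝ => h t * g t) :=
  (h.memLp 2).integrable_mul (g.memLp 2)

theorem integrable_mul_realSchwartz (ξ η : RealSchwartz) :
    Integrable (fun t : ℝ => ξ t * η t) :=
  (ξ.memLp 2).integrable_mul (η.memLp 2)

theorem bil_comm (h g : ComplexSchwartz) : bil h g = bil g h := by
  simp only [bil, mul_comm]

theorem bil_add_left (h h' g : ComplexSchwartz) : bil (h + h') g = bil h g + bil h' g := by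
  simp only [bil, add_apply, add_mul]
  exact integral_add (integrable_mul_schwartz h g) (integrable_mul_schwartz h' g)

theorem bil_smul_left (c : ℂ) (h g : ComplexSchwartz) : bil (c • h) g = c * bil h g := by
  simp only [bil, smul_apply, smul_eq_mul, mul_assoc]
  exact integral_const_mul _ _

theorem bil_add_right (h g g' : ComplexSchwartz) : bil h (g + g') = bil h g + bil h g' := by
  rw [bil_comm, bil_add_left, bil_comm g, bil_comm g']

theorem bil_smul_right (c : ℂ) (h g : ComplexSchwartz) : bil h (c • g) = c * bil h g := by
  rw [bil_comm, bil_smul_left, bil_comm]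

theorem conjS_apply (h : ComplexSchwartz) (t : ℝ) : conjS h t = (starRingEnd ℂ) (h t) := by
  rw [conjS, postcomp_apply]; rfl

theorem conjS_conjS (h : ComplexSchwartz) : conjS (conjS h) = h := by
  ext t; simp [conjS_apply]

theorem conjS_add (h g : ComplexSchwartz) : conjS (h + g) = conjS h + conjS g := by
  ext t; simp [conjS_apply]

theorem conjS_smul (c : ℂ) (h : ComplexSchwartz) :
    conjS (c • h) = (starRingEnd ℂ) c • conjS h := by
  ext t; simp [conjS_apply]

theorem conj_bil (h g : ComplexSchwartz) :
    (starRingEnd ℂ) (bil h g) = bil (conjS h) (conjS g) := by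
  rw [bil, bil, ← integral_conj]
  simp only [conjS_apply, map_mul]

theorem bil_conjS_self (h : ComplexSchwartz) :
    bil h (conjS h) = ((∫ t : ℝ, ‖h t‖ ^ 2 : ℝ) : ℂ) := by
  rw [bil, ← integral_complex_ofReal]
  simp only [conjS_apply, mul_conj, normSq_eq_norm_sq]

/-! ### White noise -/

theorem measurable_eval_real (ξ : RealSchwartz) : Measurable fun x : RealTempered => x ξ :=
  Measurable.of_comap_le (le_iSup (fun ξ : RealSchwartz =>
    MeasurableSpace.comap (fun x : RealTempered => x ξ) inferInstance) ξ)

theorem measurable_eval_complex (h : ComplexSchwartz) :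
    Measurable fun u : ComplexTempered => u h :=
  Measurable.of_comap_le (le_iSup (fun h : ComplexSchwartz =>
    MeasurableSpace.comap (fun u : ComplexTempered => u h) inferInstance) h)

theorem pair_re (h : ComplexSchwartz) (x : RealTempered) :
    (pair h x).re = x (postcomp reCLM h) := by simp [pair]

theorem pair_im (h : ComplexSchwartz) (x : RealTempered) :
    (pair h x).im = x (postcomp imCLM h) := by simp [pair]

theorem pair_add (h g : ComplexSchwartz) (x : RealTempered) :
    pair (h + g) x = pair h x + pair g x := by
  simp only [pair, map_add, ofReal_add]; ring

theorem pair_real_smul (s : ℝ) (h : ComplexSchwartz) (x : RealTempered) :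
    pair ((s : ℂ) • h) x = s * pair h x := by
  have : (s : ℂ) • h = s • h := by ext t; simp
  simp only [this, pair, map_smul, smul_eq_mul, ofReal_mul]; ring

theorem conj_pair (h : ComplexSchwartz) (x : RealTempered) :
    (starRingEnd ℂ) (pair h x) = pair (conjS h) x := by
  have h1 : postcomp reCLM (conjS h) = postcomp reCLM h := by
    ext t; simp [postcomp_apply, conjS_apply]
  have h2 : postcomp imCLM (conjS h) = -postcomp imCLM h := by
    ext t; simp [postcomp_apply, conjS_apply]
  simp [pair, h1, h2]

theorem conj_wickPow (n : ℕ) (h : ComplexSchwartz) (x : RealTempered) :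
    (starRingEnd ℂ) (wickPow n h x) = wickPow n (conjS h) x := by
  rw [wickPow_eq_wickPoly, wickPow_eq_wickPoly, conj_wickPoly, conj_bil, conj_pair]

section WhiteNoise

variable {μ : Measure RealTempered}

theorem IsWhiteNoise.isGaussianPair (hμ : IsWhiteNoise μ) (h : ComplexSchwartz) :
    IsGaussianPair μ (pair h) (∫ t : ℝ, (h t).re * (h t).re) (∫ t : ℝ, (h t).re * (h t).im)
      (∫ t : ℝ, (h t).im * (h t).im) where
  meas := by
    unfold pair
    exact (measurable_ofReal.comp (measurable_eval_real _)).add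
      ((measurable_ofReal.comp (measurable_eval_real _)).const_mul I)
  nonneg_left := integral_nonneg fun t => mul_self_nonneg _
  nonneg_right := integral_nonneg fun t => mul_self_nonneg _
  charFun a b := by
    have h1 := hμ.charFun (a • postcomp reCLM h + b • postcomp imCLM h)
    simp only [map_add, map_smul, smul_eq_mul] at h1
    simp only [pair_re, pair_im]
    rw [h1]
    congr 3
    have i1 : Integrable (fun t => (h t).re * (h t).re) := by
      simpa [postcomp_apply] using
        integrable_mul_realSchwartz (postcomp reCLM h) (postcomp reCLM h)
    have i2 : Integrable (fun t => (h t).re * (h t).im) := by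
      simpa [postcomp_apply] using
        integrable_mul_realSchwartz (postcomp reCLM h) (postcomp imCLM h)
    have i3 : Integrable (fun t => (h t).im * (h t).im) := by
      simpa [postcomp_apply] using
        integrable_mul_realSchwartz (postcomp imCLM h) (postcomp imCLM h)
    have e : ∀ t : ℝ, ((a • postcomp reCLM h + b • postcomp imCLM h) t) ^ 2 =
        a ^ 2 * ((h t).re * (h t).re) + 2 * (a * b) * ((h t).re * (h t).im) +
          b ^ 2 * ((h t).im * (h t).im) := fun t => by
      simp [postcomp_apply]; ring
    simp only [e]
    have j := (i1.const_mul (a ^ 2)).add (i2.const_mul (2 * (a * b)))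
    simp only [Pi.add_def] at j
    rw [integral_add j (i3.const_mul _),
      integral_add (i1.const_mul _) (i2.const_mul _), integral_const_mul, integral_const_mul,
      integral_const_mul]
    ring

theorem IsWhiteNoise.hasExpMoments (hμ : IsWhiteNoise μ) (h : ComplexSchwartz) :
    HasExpMoments μ (pair h) :=
  have := hμ.prob
  (hμ.isGaussianPair h).hasExpMoments

theorem bil_self_eq (h : ComplexSchwartz) :
    bil h h = ((∫ t : ℝ, (h t).re * (h t).re : ℝ) : ℂ) +
      2 * I * ((∫ t : ℝ, (h t).re * (h t).im : ℝ) : ℂ) -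
        ((∫ t : ℝ, (h t).im * (h t).im : ℝ) : ℂ) := by
  have i1 : Integrable (fun t => (((h t).re * (h t).re : ℝ) : ℂ)) := by
    simpa [postcomp_apply] using
      (integrable_mul_realSchwartz (postcomp reCLM h) (postcomp reCLM h)).ofReal (𝕜 := ℂ)
  have i2 : Integrable (fun t => (((h t).re * (h t).im : ℝ) : ℂ)) := by
    simpa [postcomp_apply] using
      (integrable_mul_realSchwartz (postcomp reCLM h) (postcomp imCLM h)).ofReal (𝕜 := ℂ)
  have i3 : Integrable (fun t => (((h t).im * (h t).im : ℝ) : ℂ)) := by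
    simpa [postcomp_apply] using
      (integrable_mul_realSchwartz (postcomp imCLM h) (postcomp imCLM h)).ofReal (𝕜 := ℂ)
  simp only [← integral_complex_ofReal]
  have j := i1.add (i2.const_mul (2 * I))
  simp only [Pi.add_def] at j
  rw [← integral_const_mul, ← integral_add i1 (i2.const_mul _), ← integral_sub j i3, bil]
  refine integral_congr_ae (Filter.Eventually.of_forall fun t => ?_)
  apply Complex.ext <;> simp <;> ring

theorem IsWhiteNoise.integral_cexp_pair (hμ : IsWhiteNoise μ) (h : ComplexSchwartz) :
    ∫ x, cexp (pair h x) ∂μ = cexp ((1 / 2 : ℂ) * bil h h) := by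
  have := hμ.prob
  rw [(hμ.isGaussianPair h).integral_cexp, bil_self_eq]

/-- In the product of two Wick exponentials the normalizations cancel the diagonal terms of the
Laplace transform, leaving `exp(st⟨h, g⟩)`. -/
theorem IsWhiteNoise.integral_wickPow_mul_wickPow (hμ : IsWhiteNoise μ) (n m : ℕ)
    (h g : ComplexSchwartz) :
    ∫ x, wickPow n h x * wickPow m g x ∂μ = if n = m then n.factorial * bil h g ^ n else 0 := by
  refine integral_wickPoly_mul_wickPoly (hμ.hasExpMoments h) (hμ.hasExpMoments g)
    (fun s t => ?_) n m
  have e := hμ.integral_cexp_pair ((s : ℂ) • h + (t : ℂ) • g)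
  simp only [pair_add, pair_real_smul, bil_add_left, bil_add_right, bil_smul_left,
    bil_smul_right, bil_comm g h] at e
  have e2 : ∀ x, cexp (s * pair h x - (1 / 2 : ℂ) * ((s : ℂ) ^ 2 * bil h h)) *
      cexp (t * pair g x - (1 / 2 : ℂ) * ((t : ℂ) ^ 2 * bil g g)) =
      cexp (-(1 / 2 : ℂ) * ((s : ℂ) ^ 2 * bil h h + (t : ℂ) ^ 2 * bil g g)) *
        cexp (s * pair h x + t * pair g x) := fun x => by
    rw [← Complex.exp_add, ← Complex.exp_add]; congr 1; ring
  simp only [e2]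
  rw [integral_const_mul, e, ← Complex.exp_add]
  congr 1; ring

end WhiteNoise

/-! ### The Bargmann--Segal measure -/

section BargmannSegal

variable {ν : Measure ComplexTempered}

theorem IsBargmannSegal.integral_cexp_re (hν : IsBargmannSegal ν) (k : ComplexSchwartz) :
    ∫ u, cexp (I * ((u k).re : ℂ)) ∂ν = cexp (-(1 / 4 : ℂ) * bil k (conjS k)) := by
  have := hν.charFun (conjS k)
  simpa [pairConj, conjS_conjS, bil_comm] using this

/-- The random variable `u h + conj (u g)` is a Gaussian pair. -/
theorem IsBargmannSegal.isGaussianPair (hν : IsBargmannSegal ν) (h g : ComplexSchwartz) :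
    IsGaussianPair ν (fun u => u h + (starRingEnd ℂ) (u g))
      (1 / 2 * (bil (h + g) (conjS (h + g))).re) (bil h (conjS g)).im
      (1 / 2 * (bil (h + (-1 : ℂ) • g) (conjS (h + (-1 : ℂ) • g))).re) where
  meas := (measurable_eval_complex h).add
    (continuous_conj.measurable.comp (measurable_eval_complex g))
  nonneg_left := by
    rw [bil_conjS_self, ofReal_re]
    exact mul_nonneg (by norm_num) (integral_nonneg fun t => by positivity)
  nonneg_right := by
    rw [bil_conjS_self, ofReal_re]
    exact mul_nonneg (by norm_num) (integral_nonneg fun t => by positivity)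
  charFun a b := by
    -- The real part of `u h + conj (u g)` is `Re u(h + g)`, and its imaginary part is `Im u(h - g)
    -- = Re u(-i(h - g))`.
    have e := hν.integral_cexp_re ((a : ℂ) • (h + g) + (-(b * I) : ℂ) • (h + (-1 : ℂ) • g))
    refine Eq.trans (integral_congr_ae (Filter.Eventually.of_forall fun u => ?_))
      (e.trans (congrArg cexp ?_))
    · simp only
      congr 3
      simp
      ring
    · have hh : bil h (conjS h) = ((bil h (conjS h)).re : ℂ) := by rw [bil_conjS_self, ofReal_re]
      have hg : bil g (conjS g) = ((bil g (conjS g)).re : ℂ) := by rw [bil_conjS_self, ofReal_re]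
      have hgh : bil g (conjS h) = (starRingEnd ℂ) (bil h (conjS g)) := by
        rw [conj_bil, conjS_conjS, bil_comm]
      simp only [bil_add_left, bil_add_right, bil_smul_left, bil_smul_right, conjS_add,
        conjS_smul, hgh]
      rw [hh, hg]
      apply Complex.ext <;> simp [pow_two] <;> ring

/-- By polarization the difference of the two variances is `2 Re⟨h, ḡ⟩`; the covariance supplies the
imaginary part. -/
theorem IsBargmannSegal.integral_cexp_add_conj (hν : IsBargmannSegal ν) (h g : ComplexSchwartz) :
    ∫ u, cexp (u h + (starRingEnd ℂ) (u g)) ∂ν = cexp (bil h (conjS g)) := by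
  have := hν.prob
  rw [(hν.isGaussianPair h g).integral_cexp]
  congr 1
  have hgh : bil g (conjS h) = (starRingEnd ℂ) (bil h (conjS g)) := by
    rw [conj_bil, conjS_conjS, bil_comm]
  simp only [bil_add_left, bil_add_right, bil_smul_left, bil_smul_right, conjS_add,
    conjS_smul, hgh]
  apply Complex.ext <;> simp <;> ring

theorem IsBargmannSegal.hasExpMoments (hν : IsBargmannSegal ν) (h : ComplexSchwartz) :
    HasExpMoments ν (fun u => u h) := by
  have := hν.prob
  simpa using (hν.isGaussianPair h 0).hasExpMoments

theorem IsBargmannSegal.integral_pow_mul_conj_pow (hν : IsBargmannSegal ν) (n m : ℕ)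
    (h g : ComplexSchwartz) :
    ∫ u, u h ^ n * (starRingEnd ℂ) (u g ^ m) ∂ν =
      if n = m then n.factorial * bil h (conjS g) ^ n else 0 := by
  have hg : HasExpMoments ν fun u => (starRingEnd ℂ) (u g) :=
    ⟨(continuous_conj.measurable.comp (measurable_eval_complex g)).aestronglyMeasurable,
      fun c => by simpa using (hν.hasExpMoments g).integrable_exp c⟩
  have := integral_wickPoly_mul_wickPoly (q := 0) (r := 0) (b := bil h (conjS g))
    (hν.hasExpMoments h) hg (fun s t => ?_) n m
  · simpa only [wickPoly_zero_left, map_pow] using this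
  · have e := hν.integral_cexp_add_conj ((s : ℂ) • h) ((t : ℂ) • g)
    simp only [bil_smul_left, bil_smul_right, conjS_smul, conj_ofReal, mul_left_comm (t : ℂ)] at e
    rw [mul_assoc, ← e]
    refine integral_congr_ae (Filter.Eventually.of_forall fun u => ?_)
    simp [← Complex.exp_add]

end BargmannSegal

/-! ### Wick exponentials are total -/

theorem integrable_cexp_mul {Ω : Type*} [MeasurableSpace Ω] {P : Measure Ω} {X : Ω → ℝ}
    (hX : Measurable X) {f : Ω → ℂ} (hf : Integrable f P) :
    Integrable (fun x => cexp (I * (X x : ℂ)) * f x) P := by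
  refine hf.bdd_mul (c := 1) (by fun_prop) (Filter.Eventually.of_forall fun x => ?_)
  rw [mul_comm, Complex.norm_exp_ofReal_mul_I]

/-- Finite measures on `𝒮'` with equal characteristic functions are equal. -/
theorem measure_ext_of_charFun {P Q : Measure RealTempered} [IsFiniteMeasure P]
    [IsFiniteMeasure Q]
    (h : ∀ ξ : RealSchwartz, ∫ x, cexp (I * (x ξ : ℂ)) ∂P = ∫ x, cexp (I * (x ξ : ℂ)) ∂Q) :
    P = Q := by
  -- The cylinder σ-algebra is the pullback under `J` of the product σ-algebra, where finite
  -- measures are determined by their finite-dimensional marginals.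
  let J : RealTempered → RealSchwartz → ℝ := fun x ξ => x ξ
  have hJ : Measurable J := measurable_pi_lambda _ fun ξ => measurable_eval_real ξ
  have hmap : P.map J = Q.map J := by
    have hfin : ∀ s : Finset RealSchwartz,
        (P.map J).map s.restrict = (Q.map J).map s.restrict := fun s => by
      classical
      have hr : Measurable (s.restrict (π := fun _ => ℝ)) := by fun_prop
      rw [Measure.map_map hr hJ, Measure.map_map hr hJ]
      refine Measure.ext_of_charFunDual (funext fun L => ?_)
      -- A linear functional of finitely many evaluations is evaluation at one test function, so the
      -- hypothesis covers all marginals.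
      have hL : ∀ x : RealTempered, L ((s.restrict ∘ J) x) =
          x (∑ i : s, L (Pi.single i 1) • (i : RealSchwartz)) := fun x => by
        rw [map_sum]
        conv_lhs => rw [← Finset.univ_sum_single ((s.restrict ∘ J) x), map_sum]
        refine Finset.sum_congr rfl fun i _ => ?_
        rw [map_smul, smul_eq_mul, mul_comm, ← smul_eq_mul, ← map_smul, ← Pi.single_smul]
        simp [J]
      rw [charFunDual_apply, charFunDual_apply,
        integral_map (hr.comp hJ).aemeasurable (by fun_prop),
        integral_map (hr.comp hJ).aemeasurable (by fun_prop)]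
      simp only [hL, mul_comm _ I]
      exact h _
    exact IsProjectiveLimit.unique (P := fun s : Finset RealSchwartz => (P.map J).map s.restrict)
      (fun s => rfl) (fun s => (hfin s).symm)
  ext A hA
  have hcomap : (inferInstance : MeasurableSpace RealTempered) =
      MeasurableSpace.comap J inferInstance := by
    simp only [MeasurableSpace.pi, MeasurableSpace.comap_iSup, MeasurableSpace.comap_comp]
    rfl
  have hA' : MeasurableSet[MeasurableSpace.comap J inferInstance] A := hcomap ▸ hA
  obtain ⟨B, hB, rfl⟩ := hA'
  rw [← Measure.map_apply hJ hB, hmap, Measure.map_apply hJ hB]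

/-- The positive and negative parts of `f` are densities of finite measures with the same
characteristic function; these measures coincide, so the two parts agree almost everywhere. -/
theorem ae_eq_zero_of_charFun_eq_zero_real {μ : Measure RealTempered} {f : RealTempered → ℝ}
    (hf : Integrable f μ)
    (h : ∀ ξ : RealSchwartz, ∫ x, cexp (I * (x ξ : ℂ)) * (f x : ℂ) ∂μ = 0) : f =ᵐ[μ] 0 := by
  obtain ⟨g, hg, hfg⟩ := hf.1
  have hgi : Integrable g μ := hf.congr hfg
  have hgm : Measurable g := hg.measurable
  have h' : ∀ ξ : RealSchwartz, ∫ x, cexp (I * (x ξ : ℂ)) * (g x : ℂ) ∂μ = 0 := fun ξ => by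
    rw [← h ξ]
    refine integral_congr_ae ?_
    filter_upwards [hfg] with x hx
    rw [hx]
  have hp : ∀ g : RealTempered → ℝ, Integrable g μ → IsFiniteMeasure
      (μ.withDensity fun x => ((g x).toNNReal : ℝ≥0∞)) := fun g hg =>
    isFiniteMeasure_withDensity_ofReal hg.2
  have := hp g hgi
  have := hp (fun x => -g x) hgi.neg
  have hint : ∀ g : RealTempered → ℝ, Measurable g → Integrable g μ → ∀ ξ : RealSchwartz,
      Integrable (fun x => cexp (I * (x ξ : ℂ)) * ((g x).toNNReal : ℂ)) μ := fun g hg hgi ξ => by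
    have h1 : Integrable (fun x => (((g x).toNNReal : ℝ) : ℂ)) μ := by
      simpa using hgi.real_toNNReal.ofReal (𝕜 := ℂ)
    exact integrable_cexp_mul (measurable_eval_real ξ) h1
  have heq : (μ.withDensity fun x => ((g x).toNNReal : ℝ≥0∞)) =
      μ.withDensity fun x => ((-g x).toNNReal : ℝ≥0∞) := by
    refine measure_ext_of_charFun fun ξ => ?_
    rw [integral_withDensity_eq_integral_smul hgm.real_toNNReal,
      integral_withDensity_eq_integral_smul (f := fun x => (-g x).toNNReal)
        hgm.neg.real_toNNReal, ← sub_eq_zero,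
      ← integral_sub, ← h' ξ]
    · refine integral_congr_ae (Filter.Eventually.of_forall fun x => ?_)
      have e : (g x : ℂ) = ((g x).toNNReal : ℂ) - ((-g x).toNNReal : ℂ) := by
        have := Real.coe_toNNReal' (g x)
        have := Real.coe_toNNReal' (-g x)
        rcases le_total 0 (g x) with h0 | h0
        · simp [h0]
        · simp [h0]
      simp only [NNReal.smul_def, real_smul]
      rw [e]; ring
    · refine (hint g hgm hgi ξ).congr (Filter.Eventually.of_forall fun x => ?_)
      simp only [NNReal.smul_def, real_smul]; ring
    · refine (hint _ hgm.neg hgi.neg ξ).congr (Filter.Eventually.of_forall fun x => ?_)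
      simp only [NNReal.smul_def, real_smul, Pi.neg_apply]; ring
  rw [withDensity_eq_iff (by fun_prop) (by fun_prop)] at heq
  · filter_upwards [hfg, heq] with x hx hx'
    rw [hx]
    have hx'' : (g x).toNNReal = (-g x).toNNReal := by exact_mod_cast hx'
    rcases lt_trichotomy 0 (g x) with h0 | h0 | h0
    · rw [Real.toNNReal_of_nonpos (by linarith : -g x ≤ 0), Real.toNNReal_eq_zero] at hx''
      linarith
    · exact h0.symm
    · rw [Real.toNNReal_of_nonpos h0.le, eq_comm, Real.toNNReal_eq_zero] at hx''
      linarith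
  · have := (hp g hgi).measure_univ_lt_top
    rw [withDensity_apply _ MeasurableSet.univ, Measure.restrict_univ] at this
    exact this.ne

/-- Conjugating the hypothesis at `-ξ` gives it for the conjugate of `f`, hence for the real and
imaginary parts. -/
theorem ae_eq_zero_of_charFun_eq_zero {μ : Measure RealTempered} {f : RealTempered → ℂ}
    (hf : Integrable f μ)
    (h : ∀ ξ : RealSchwartz, ∫ x, cexp (I * (x ξ : ℂ)) * f x ∂μ = 0) : f =ᵐ[μ] 0 := by
  have hc : ∀ ξ : RealSchwartz, ∫ x, cexp (I * (x ξ : ℂ)) * (starRingEnd ℂ) (f x) ∂μ = 0 :=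
    fun ξ => by
    have := congrArg (starRingEnd ℂ) (h (-ξ))
    rw [← integral_conj, map_zero] at this
    rw [← this]
    refine integral_congr_ae (Filter.Eventually.of_forall fun x => ?_)
    simp [← Complex.exp_conj]
  have hfc : Integrable (fun x => (starRingEnd ℂ) (f x)) μ :=
    ⟨continuous_conj.comp_aestronglyMeasurable hf.1, by simpa [HasFiniteIntegral] using hf.2⟩
  have hre := ae_eq_zero_of_charFun_eq_zero_real hf.re fun ξ => by
    have e : ∀ x, cexp (I * (x ξ : ℂ)) * ((RCLike.re (f x) : ℝ) : ℂ) =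
        (1 / 2 : ℂ) * (cexp (I * (x ξ : ℂ)) * f x +
          cexp (I * (x ξ : ℂ)) * (starRingEnd ℂ) (f x)) := fun x => by
      rw [← mul_add, add_conj]
      simp; ring
    simp only [e]
    rw [integral_const_mul, integral_add (integrable_cexp_mul (measurable_eval_real ξ) hf)
      (integrable_cexp_mul (measurable_eval_real ξ) hfc), h, hc]
    simp
  have him := ae_eq_zero_of_charFun_eq_zero_real hf.im fun ξ => by
    have e : ∀ x, cexp (I * (x ξ : ℂ)) * ((RCLike.im (f x) : ℝ) : ℂ) =
        (-I / 2 : ℂ) * (cexp (I * (x ξ : ℂ)) * f x -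
          cexp (I * (x ξ : ℂ)) * (starRingEnd ℂ) (f x)) := fun x => by
      rw [← mul_sub, sub_conj]
      have : I * I = -1 := I_mul_I
      simp; linear_combination (cexp (I * (x ξ : ℂ)) * (f x).im) * this
    simp only [e]
    rw [integral_const_mul, integral_sub (integrable_cexp_mul (measurable_eval_real ξ) hf)
      (integrable_cexp_mul (measurable_eval_real ξ) hfc), h, hc]
    simp
  filter_upwards [hre, him] with x h1 h2
  exact Complex.ext h1 h2

/-- At `iξ` with `ξ` real, the Wick exponential is `exp(i⟨ξ, x⟩)` up to a nonzero constant. -/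
theorem IsWhiteNoise.eq_zero_of_sTransform {μ : Measure RealTempered} (hμ : IsWhiteNoise μ)
    {F : Lp ℂ 2 μ} (h : ∀ k, sTransform μ F k = 0) : F = 0 := by
  have := hμ.prob
  rw [Lp.eq_zero_iff_ae_eq_zero]
  refine ae_eq_zero_of_charFun_eq_zero ((Lp.memLp F).integrable (by norm_num)) fun ξ => ?_
  have hk := h (I • postcomp ofRealCLM ξ)
  have e : ∀ x : RealTempered, pair (I • postcomp ofRealCLM ξ) x = I * (x ξ : ℂ) := fun x => by
    have h1 : postcomp reCLM (I • postcomp ofRealCLM ξ) = 0 := by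
      ext t; simp [postcomp_apply]
    have h2 : postcomp imCLM (I • postcomp ofRealCLM ξ) = ξ := by
      ext t; simp [postcomp_apply]
    rw [pair, h1, h2]; simp
  simp only [sTransform, wickExp, e, Complex.exp_sub, div_mul_eq_mul_div] at hk
  rw [integral_div, div_eq_zero_iff] at hk
  exact hk.resolve_right (Complex.exp_ne_zero _)

/-! ### Tensor powers, Wick powers and monomials as elements of `L²` -/

theorem inner_toLp {Ω : Type*} [MeasurableSpace Ω] {P : Measure Ω} {f : Ω → ℂ}
    (hf : MemLp f 2 P) (G : Lp ℂ 2 P) :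
    inner ℂ (hf.toLp f) G = ∫ x, (starRingEnd ℂ) (f x) * G x ∂P := by
  rw [L2.inner_def]
  refine integral_congr_ae ?_
  filter_upwards [hf.coeFn_toLp] with x hx
  rw [hx, RCLike.inner_apply, mul_comm]

theorem inner_toLp_toLp {Ω : Type*} [MeasurableSpace Ω] {P : Measure Ω} {f g : Ω → ℂ}
    (hf : MemLp f 2 P) (hg : MemLp g 2 P) :
    inner ℂ (hf.toLp f) (hg.toLp g) = ∫ x, (starRingEnd ℂ) (f x) * g x ∂P := by
  rw [inner_toLp hf]
  refine integral_congr_ae ?_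
  filter_upwards [hg.coeFn_toLp] with x hx
  rw [hx]

theorem conj_tensorPow (n : ℕ) (h : ComplexSchwartz) (t : Fin n → ℝ) :
    (starRingEnd ℂ) (tensorPow n h t) = tensorPow n (conjS h) t := by
  simp [tensorPow, conjS_apply]

theorem memLp_tensorPow (n : ℕ) (h : ComplexSchwartz) : MemLp (tensorPow n h) 2 volume := by
  have hc : Continuous (tensorPow n h) := by
    unfold tensorPow
    exact continuous_finsetProd _ fun i _ => h.continuous.comp (continuous_apply i)
  rw [memLp_two_iff_integrable_sq_norm hc.aestronglyMeasurable]
  have := Integrable.fintype_prod (ι := Fin n) (f := fun _ t => ‖h t‖ ^ 2)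
    (μ := fun _ => volume) fun _ => (h.memLp 2).integrable_norm_pow two_ne_zero
  simp only [Finset.prod_pow] at this
  simp only [tensorPow, norm_prod]
  exact this

/-- The tensor power `h^{⊗n}` as a kernel. -/
def tensorLp (n : ℕ) (h : ComplexSchwartz) : Kernel n := (memLp_tensorPow n h).toLp _

theorem inner_tensorLp (n : ℕ) (h : ComplexSchwartz) (g : Kernel n) :
    inner ℂ (tensorLp n (conjS h)) g = ∫ t : Fin n → ℝ, g t * tensorPow n h t := by
  rw [tensorLp, inner_toLp]
  simp only [conj_tensorPow, conjS_conjS, mul_comm]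

theorem inner_tensorLp_tensorLp (n : ℕ) (h g : ComplexSchwartz) :
    inner ℂ (tensorLp n h) (tensorLp n g) = bil (conjS h) g ^ n := by
  rw [tensorLp, tensorLp, inner_toLp_toLp]
  simp only [conj_tensorPow]
  simp only [tensorPow, ← Finset.prod_mul_distrib]
  rw [integral_fintype_prod_volume_eq_pow fun t => conjS h t * g t, Fintype.card_fin, bil]

/-- The elements of the closed span of the tensor powers are symmetric. -/
theorem isSymmKernel_of_mem {n : ℕ} {g : Kernel n}
    (hg : g ∈ (Submodule.span ℂ (Set.range (tensorLp n))).topologicalClosure) :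
    IsSymmKernel g := by
  intro σ
  have hmp : MeasurePreserving (fun t : Fin n → ℝ => fun i => t (σ i)) volume volume := by
    simpa using! (volume_measurePreserving_piCongrLeft (fun _ : Fin n => ℝ) σ).symm
  let C : Kernel n →L[ℂ] Kernel n :=
    (Lp.compMeasurePreservingₗᵢ ℂ (fun t : Fin n → ℝ => fun i => t (σ i)) hmp).toContinuousLinearMap
  have hC : ∀ f : Kernel n, C f =ᵐ[volume] fun t => f (fun i => t (σ i)) := fun f =>
    Lp.coeFn_compMeasurePreserving f hmp
  -- The fixed points of the permutation operator `C` form a closed subspace containing the tensor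
  -- powers.
  have hle : (Submodule.span ℂ (Set.range (tensorLp n))).topologicalClosure ≤
      (LinearMap.eqLocus (C : Kernel n →ₗ[ℂ] Kernel n) LinearMap.id) := by
    refine Submodule.topologicalClosure_minimal _ (Submodule.span_le.mpr ?_)
      (isClosed_eq C.continuous continuous_id)
    rintro _ ⟨h, rfl⟩
    change C (tensorLp n h) = tensorLp n h
    refine Lp.ext ((hC _).trans ?_)
    have h1 : tensorLp n h =ᵐ[volume] tensorPow n h := MemLp.coeFn_toLp _
    have h2 := hmp.quasiMeasurePreserving.ae_eq_comp h1
    filter_upwards [h1, h2] with t e1 e2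
    simp only [Function.comp_apply] at e2
    rw [e1, e2]
    exact Equiv.prod_comp σ fun i => h (t i)
  have e : C g = g := hle hg
  have := hC g
  rw [e] at this
  exact this.symm

section

variable {μ : Measure RealTempered} {ν : Measure ComplexTempered}

theorem IsWhiteNoise.memLp_wickPow (hμ : IsWhiteNoise μ) (n : ℕ) (h : ComplexSchwartz) :
    MemLp (wickPow n h) 2 μ :=
  (hμ.hasExpMoments h).memLp_wickPoly n (bil h h)

theorem IsBargmannSegal.memLp_pow (hν : IsBargmannSegal ν) (n : ℕ) (h : ComplexSchwartz) :
    MemLp (fun u : ComplexTempered => u h ^ n) 2 ν := by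
  simpa only [wickPoly_zero_left] using (hν.hasExpMoments h).memLp_wickPoly n 0

/-- The Wick power `⟨h^{⊗n}, :·^{⊗n}:⟩` as an element of `L²(μ)`. -/
def wickLp (hμ : IsWhiteNoise μ) (n : ℕ) (h : ComplexSchwartz) : Lp ℂ 2 μ :=
  (hμ.memLp_wickPow n h).toLp _

/-- The monomial `⟨h, ·⟩ⁿ` as an element of `L²(ν)`. -/
def monomialLp (hν : IsBargmannSegal ν) (n : ℕ) (h : ComplexSchwartz) : Lp ℂ 2 ν :=
  (hν.memLp_pow n h).toLp _

theorem inner_wickLp_of_ne (hμ : IsWhiteNoise μ) {n m : ℕ} (hnm : n ≠ m) (h g : ComplexSchwartz) :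
    inner ℂ (wickLp hμ n h) (wickLp hμ m g) = 0 := by
  rw [wickLp, wickLp, inner_toLp_toLp]
  simp only [conj_wickPow]
  rw [hμ.integral_wickPow_mul_wickPow, if_neg hnm]

theorem inner_wickLp (hμ : IsWhiteNoise μ) (n : ℕ) (h g : ComplexSchwartz) :
    inner ℂ (wickLp hμ n h) (wickLp hμ n g) =
      ((n.factorial : ℝ) : ℂ) * inner ℂ (tensorLp n h) (tensorLp n g) := by
  rw [wickLp, wickLp, inner_toLp_toLp, inner_tensorLp_tensorLp]
  simp only [conj_wickPow]
  rw [hμ.integral_wickPow_mul_wickPow, if_pos rfl, ofReal_natCast]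

theorem inner_monomialLp_of_ne (hν : IsBargmannSegal ν) {n m : ℕ} (hnm : n ≠ m)
    (h g : ComplexSchwartz) : inner ℂ (monomialLp hν n h) (monomialLp hν m g) = 0 := by
  rw [monomialLp, monomialLp, inner_toLp_toLp]
  simp only [mul_comm ((starRingEnd ℂ) _)]
  rw [hν.integral_pow_mul_conj_pow, if_neg hnm.symm]

theorem inner_monomialLp (hν : IsBargmannSegal ν) (n : ℕ) (h g : ComplexSchwartz) :
    inner ℂ (monomialLp hν n h) (monomialLp hν n g) =
      ((n.factorial : ℝ) : ℂ) * inner ℂ (tensorLp n h) (tensorLp n g) := by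
  rw [monomialLp, monomialLp, inner_toLp_toLp, inner_tensorLp_tensorLp]
  simp only [mul_comm ((starRingEnd ℂ) _)]
  rw [hν.integral_pow_mul_conj_pow, if_pos rfl, ofReal_natCast, bil_comm]

theorem topologicalClosure_span_eq_graphClosure {Ω : Type*} [MeasurableSpace Ω] {P : Measure Ω}
    (n : ℕ) {f : ComplexSchwartz → Ω → ℂ} (hf : ∀ h, MemLp (f h) 2 P) :
    (Submodule.span ℂ {p : Kernel n × Lp ℂ 2 P | ∃ h : ComplexSchwartz,
      p.1 =ᵐ[volume] tensorPow n h ∧ p.2 =ᵐ[P] f h}).topologicalClosure =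
      graphClosure (tensorLp n) (fun h => (hf h).toLp (f h)) := by
  rw [graphClosure]
  congr 2
  ext p
  constructor
  · rintro ⟨h, h1, h2⟩
    exact ⟨h, Prod.ext (Lp.ext ((memLp_tensorPow n h).coeFn_toLp.trans h1.symm))
      (Lp.ext ((hf h).coeFn_toLp.trans h2.symm))⟩
  · rintro ⟨h, rfl⟩
    exact ⟨h, (memLp_tensorPow n h).coeFn_toLp, (hf h).coeFn_toLp⟩

theorem wienerGraph_eq (hμ : IsWhiteNoise μ) (n : ℕ) :
    wienerGraph μ n = graphClosure (tensorLp n) (wickLp hμ n) :=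
  topologicalClosure_span_eq_graphClosure n (hμ.memLp_wickPow n)

theorem monomialGraph_eq (hν : IsBargmannSegal ν) (n : ℕ) :
    monomialGraph ν n = graphClosure (tensorLp n) (monomialLp hν n) :=
  topologicalClosure_span_eq_graphClosure n (hν.memLp_pow n)

end

/-! ### Chaos expansions -/

theorem inner_eq_zero_of_mem_topologicalClosure {E S S' : Type*} [NormedAddCommGroup E]
    [InnerProductSpace ℂ E] {W : S → E} {W' : S' → E} (h : ∀ s s', inner ℂ (W s) (W' s') = 0)
    {x y : E} (hx : x ∈ (Submodule.span ℂ (Set.range W)).topologicalClosure)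
    (hy : y ∈ (Submodule.span ℂ (Set.range W')).topologicalClosure) : inner ℂ x y = 0 := by
  have h1 : Submodule.span ℂ (Set.range W') ≤ (Submodule.span ℂ (Set.range W))ᗮ := by
    refine (Submodule.isOrtho_span.mpr ?_).symm
    rintro _ ⟨s, rfl⟩ _ ⟨s', rfl⟩
    exact h s s'
  have h2 := Submodule.topologicalClosure_minimal _ h1 (Submodule.isClosed_orthogonal _)
  rw [← Submodule.orthogonal_closure] at h2
  exact (Submodule.mem_orthogonal _ _).mp (h2 hy) x hx

theorem norm_sq_eq_integral {Ω : Type*} [MeasurableSpace Ω] {P : Measure Ω} (H : Lp ℂ 2 P) :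
    ∫ x, ‖H x‖ ^ 2 ∂P = ‖H‖ ^ 2 := by
  have h := L2.inner_def (𝕜 := ℂ) H H
  simp only [inner_self_eq_norm_sq_to_K, coe_algebraMap, ← ofReal_pow] at h
  rw [integral_complex_ofReal] at h
  exact_mod_cast h.symm

section

variable {μ : Measure RealTempered} {ν : Measure ComplexTempered}

/-- The `n`-th Wiener chaos. -/
def wienerChaos (hμ : IsWhiteNoise μ) (n : ℕ) : Submodule ℂ (Lp ℂ 2 μ) :=
  (Submodule.span ℂ (Set.range (wickLp hμ n))).topologicalClosure

theorem inner_wienerChaos_of_ne (hμ : IsWhiteNoise μ) {n m : ℕ} (hnm : n ≠ m) {x y : Lp ℂ 2 μ}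
    (hx : x ∈ wienerChaos hμ n) (hy : y ∈ wienerChaos hμ m) : inner ℂ x y = 0 :=
  inner_eq_zero_of_mem_topologicalClosure (inner_wickLp_of_ne hμ hnm) hx hy

theorem wickLp_mem_wienerChaos (hμ : IsWhiteNoise μ) (n : ℕ) (h : ComplexSchwartz) :
    wickLp hμ n h ∈ wienerChaos hμ n :=
  Submodule.le_topologicalClosure _ (Submodule.subset_span ⟨h, rfl⟩)

theorem snd_mem_wienerChaos (hμ : IsWhiteNoise μ) {n : ℕ} {p : Kernel n × Lp ℂ 2 μ}
    (hp : p ∈ wienerGraph μ n) : p.2 ∈ wienerChaos hμ n := by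
  rw [wienerGraph_eq hμ] at hp
  exact snd_mem_of_mem_graphClosure hp

/-- The inner product conjugates its first argument, whereas the `S`-transform is bilinear; hence
`conjS h`. -/
theorem hasSum_scaledS_inner (hμ : IsWhiteNoise μ) (F : Lp ℂ 2 μ) (l : ℝ) (h : ComplexSchwartz) :
    HasSum (fun n : ℕ => (l : ℂ) ^ n * (inner ℂ (wickLp hμ n (conjS h)) F / (n.factorial : ℂ)))
      (scaledS μ F l h) := by
  refine hasSum_of_eq ((hμ.hasExpMoments h).hasSum_integral_scaled (bil h h) (Lp.memLp F) l)
    (fun n => ?_) ?_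
  · rw [wickLp, inner_toLp]
    simp only [conj_wickPow, conjS_conjS]
    rfl
  · simp only [scaledS, sTransform, wickExp, pair_real_smul, bil_smul_left, bil_smul_right,
      ← mul_assoc, pow_two]

theorem eq_zero_of_inner_wickLp (hμ : IsWhiteNoise μ) {F : Lp ℂ 2 μ}
    (h : ∀ n k, inner ℂ (wickLp hμ n k) F = 0) : F = 0 := by
  refine hμ.eq_zero_of_sTransform fun k => ?_
  have := hasSum_scaledS_inner hμ F 1 k
  simp only [h, zero_div, mul_zero, scaledS, ofReal_one, one_smul] at this
  exact this.unique hasSum_zero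

/-- The Wiener--Itô chaos decomposition. -/
theorem exists_chaosExpansion (hμ : IsWhiteNoise μ) (F : Lp ℂ 2 μ) :
    ∃ (f : KernelSeq) (w : ℕ → Lp ℂ 2 μ), (∀ n, (f n, w n) ∈ wienerGraph μ n) ∧ HasSum w F := by
  have hcomp : ∀ n, CompleteSpace (wienerChaos hμ n) := fun n =>
    (Submodule.isClosed_topologicalClosure _).completeSpace_coe
  have hV : OrthogonalFamily ℂ (fun n => wienerChaos hμ n)
      (fun n => (wienerChaos hμ n).subtypeₗᵢ) := fun i j hij x y =>
    inner_wienerChaos_of_ne hμ hij x.2 y.2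
  -- A vector orthogonal to every chaos has vanishing `S`-transform, hence is zero.
  have hs := IsHilbertSum.mkInternal (wienerChaos hμ) hV (by
    rw [top_le_iff, Submodule.topologicalClosure_eq_top_iff, Submodule.eq_bot_iff]
    intro G hG
    refine eq_zero_of_inner_wickLp hμ fun n k => ?_
    exact (Submodule.mem_orthogonal _ _).mp hG _
      (Submodule.mem_iSup_of_mem n (wickLp_mem_wienerChaos hμ n k)))
  have hF := hs.hasSum_linearIsometryEquiv_symm (hs.linearIsometryEquiv F)
  rw [LinearIsometryEquiv.symm_apply_apply] at hF
  have hk : ∀ n, ∃ k, (k, (hs.linearIsometryEquiv F n : Lp ℂ 2 μ)) ∈ wienerGraph μ n := fun n => by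
    rw [wienerGraph_eq hμ]
    exact exists_mem_graphClosure_of_snd (Nat.cast_pos.mpr n.factorial_pos) (inner_wickLp hμ n)
      (hs.linearIsometryEquiv F n).2
  choose f hf using hk
  exact ⟨f, _, hf, hF⟩

theorem isSymmKernel_of_mem_wienerGraph (hμ : IsWhiteNoise μ) {n : ℕ} {p : Kernel n × Lp ℂ 2 μ}
    (hp : p ∈ wienerGraph μ n) : IsSymmKernel p.1 := by
  rw [wienerGraph_eq hμ] at hp
  exact isSymmKernel_of_mem (fst_mem_of_mem_graphClosure hp)

theorem norm_sq_wienerGraph (hμ : IsWhiteNoise μ) {n : ℕ} {p : Kernel n × Lp ℂ 2 μ}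
    (hp : p ∈ wienerGraph μ n) : ‖p.2‖ ^ 2 = n.factorial * ‖p.1‖ ^ 2 := by
  rw [wienerGraph_eq hμ] at hp
  exact norm_sq_graphClosure (inner_wickLp hμ n) hp

theorem norm_sq_monomialGraph (hν : IsBargmannSegal ν) {n : ℕ} {p : Kernel n × Lp ℂ 2 ν}
    (hp : p ∈ monomialGraph ν n) : ‖p.2‖ ^ 2 = n.factorial * ‖p.1‖ ^ 2 := by
  rw [monomialGraph_eq hν] at hp
  exact norm_sq_graphClosure (inner_monomialLp hν n) hp

/-! ### Extensions to the Bargmann--Segal space -/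

theorem tensorPow_smul (n : ℕ) (c : ℂ) (h : ComplexSchwartz) (t : Fin n → ℝ) :
    tensorPow n (c • h) t = c ^ n * tensorPow n h t := by
  simp [tensorPow, Finset.prod_mul_distrib]

/-- Along `s ↦ sh` both expansions of `U` are power series in `s`, so the kernels have equal
pairings with every `h^{⊗n}`. Their difference lies in the closed span of the tensor powers and so
vanishes; the norm identity then identifies the terms in `L²(ν)`. -/
theorem IsBSExtension.unique (hν : IsBargmannSegal ν) {U : ComplexSchwartz → ℂ} {H H' : Lp ℂ 2 ν}
    (hH : IsBSExtension ν U H) (hH' : IsBSExtension ν U H') : H = H' := by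
  obtain ⟨g, -, hg, M, hM, hMH⟩ := hH
  obtain ⟨g', -, hg', M', hM', hMH'⟩ := hH'
  have hsc : ∀ (g : KernelSeq), (∀ h : ComplexSchwartz,
      HasSum (fun n : ℕ => ∫ t : Fin n → ℝ, g n t * tensorPow n h t) (U h)) →
      ∀ (h : ComplexSchwartz) (s : ℝ), HasSum (fun n : ℕ =>
        (s : ℂ) ^ n * ∫ t : Fin n → ℝ, g n t * tensorPow n h t) (U ((s : ℂ) • h)) :=
    fun g hg h s => by
      refine hasSum_of_eq (hg ((s : ℂ) • h)) (fun n => ?_) rfl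
      simp only [tensorPow_smul, mul_left_comm _ ((s : ℂ) ^ n)]
      exact integral_const_mul _ _
  have hd : ∀ n, (g n - g' n, M n - M' n) ∈ graphClosure (tensorLp n) (monomialLp hν n) :=
    fun n => by
      rw [← monomialGraph_eq hν]
      exact Submodule.sub_mem _ (hM n) (hM' n)
  have hz : ∀ n, g n - g' n = 0 := fun n => by
    refine eq_zero_of_forall_inner_eq_zero (fst_mem_of_mem_graphClosure (hd n)) fun h => ?_
    have := congrFun (coeff_eq_of_forall_hasSum (hsc g hg (conjS h)) (hsc g' hg' (conjS h))) n
    rw [← inner_tensorLp, ← inner_tensorLp, conjS_conjS] at this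
    rw [inner_sub_right, this, sub_self]
  have hMM : M = M' := funext fun n => by
    have := norm_sq_graphClosure (inner_monomialLp hν n) (hd n)
    rw [hz n, norm_zero, zero_pow two_ne_zero, mul_zero, sq_eq_zero_iff, norm_eq_zero] at this
    exact sub_eq_zero.mp this
  exact hMH.unique (hMM ▸ hMH')

theorem bsExtension_eq (hν : IsBargmannSegal ν) {U : ComplexSchwartz → ℂ} {H : Lp ℂ 2 ν}
    (hH : IsBSExtension ν U H) : bsExtension ν U = H := by
  have hex : ∃ H : Lp ℂ 2 ν, IsBSExtension ν U H := ⟨H, hH⟩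
  rw [bsExtension, dif_pos hex]
  exact hex.choose_spec.unique hν hH

variable {F : Lp ℂ 2 μ} {f : KernelSeq} {w : ℕ → Lp ℂ 2 μ}

theorem pairwise_inner_eq_zero (hμ : IsWhiteNoise μ) (hw : ∀ n, (f n, w n) ∈ wienerGraph μ n) :
    Pairwise fun i j => inner ℂ (w i) (w j) = 0 := fun i j hij =>
  inner_wienerChaos_of_ne hμ hij (snd_mem_wienerChaos hμ (hw i)) (snd_mem_wienerChaos hμ (hw j))

/-- Only the `n`-th chaos meets the `n`-th Wick power, and the `n!` of their inner product cancels
the `1 / n!` of the exponential. -/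
theorem hasSum_scaledS (hμ : IsWhiteNoise μ) (hw : ∀ n, (f n, w n) ∈ wienerGraph μ n)
    (hF : HasSum w F) (l : ℝ) (h : ComplexSchwartz) :
    HasSum (fun n : ℕ => (l : ℂ) ^ n * ∫ t : Fin n → ℝ, f n t * tensorPow n h t)
      (scaledS μ F l h) := by
  refine hasSum_of_eq (hasSum_scaledS_inner hμ F l h) (fun n => ?_) rfl
  have hp := hw n
  rw [wienerGraph_eq hμ] at hp
  rw [inner_eq_of_hasSum hF (n := n) fun j hj => inner_wienerChaos_of_ne hμ hj.symm
      (wickLp_mem_wienerChaos hμ n _) (snd_mem_wienerChaos hμ (hw j)),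
    inner_graphClosure (inner_wickLp hμ n) (mem_graphClosure (conjS h)) hp, ofReal_natCast,
    mul_div_cancel_left₀ _ (Nat.cast_ne_zero.mpr n.factorial_ne_zero), inner_tensorLp]

/-- The kernels `λⁿ fₙ` are transported to `L²(ν)`. Both graphs scale norms by `√n!`, so the terms
have squared norm `‖wₙ‖² λ^{2n}`, and they are orthogonal. -/
theorem exists_isBSExtension (hμ : IsWhiteNoise μ) (hν : IsBargmannSegal ν)
    (hw : ∀ n, (f n, w n) ∈ wienerGraph μ n) (hF : HasSum w F) {l : ℝ}
    (hl : l ∈ Set.Ioo (0 : ℝ) 1) :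
    ∃ H : Lp ℂ 2 ν, IsBSExtension ν (scaledS μ F l) H ∧
      ‖H‖ ^ 2 = ∑' n, ‖w n‖ ^ 2 * l ^ (2 * n) := by
  have hmem : ∀ n, (l : ℂ) ^ n • f n ∈
      (Submodule.span ℂ (Set.range (tensorLp n))).topologicalClosure := fun n => by
    have hp := hw n
    rw [wienerGraph_eq hμ] at hp
    exact Submodule.smul_mem _ _ (fst_mem_of_mem_graphClosure hp)
  have hk : ∀ n, ∃ M, ((l : ℂ) ^ n • f n, M) ∈ monomialGraph ν n := fun n => by
    rw [monomialGraph_eq hν]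
    exact exists_mem_graphClosure_of_fst (Nat.cast_pos.mpr n.factorial_pos)
      (inner_monomialLp hν n) (hmem n)
  choose M hM using hk
  have hnorm : ∀ n, ‖M n‖ ^ 2 = ‖w n‖ ^ 2 * l ^ (2 * n) := fun n => by
    have h1 := norm_sq_monomialGraph hν (hM n)
    have h2 := norm_sq_wienerGraph hμ (hw n)
    simp only [norm_smul, norm_pow, norm_real, Real.norm_eq_abs, abs_of_pos hl.1] at h1 h2
    rw [h1, h2]; ring
  have hort : Pairwise fun i j => inner ℂ (M i) (M j) = 0 := fun i j hij => by
    have hi := hM i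
    have hj := hM j
    rw [monomialGraph_eq hν] at hi hj
    exact inner_eq_zero_of_mem_topologicalClosure (inner_monomialLp_of_ne hν hij)
      (snd_mem_of_mem_graphClosure hi) (snd_mem_of_mem_graphClosure hj)
  have hsum : Summable M := by
    rw [summable_iff_of_pairwise_orthogonal hort]
    refine Summable.of_nonneg_of_le (fun n => by positivity) (fun n => ?_)
      (hasSum_norm_sq_of_pairwise_orthogonal hF (pairwise_inner_eq_zero hμ hw)).summable
    rw [hnorm]
    exact mul_le_of_le_one_right (by positivity) (pow_le_one₀ hl.1.le hl.2.le)
  refine ⟨∑' n, M n, ⟨fun n => (l : ℂ) ^ n • f n, fun n => isSymmKernel_of_mem (hmem n),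
    fun h => ?_, M, hM, hsum.hasSum⟩, ?_⟩
  · refine hasSum_of_eq (hasSum_scaledS hμ hw hF l h) (fun n => ?_) rfl
    rw [← inner_tensorLp, ← inner_tensorLp, inner_smul_right]
  · rw [← (hasSum_norm_sq_of_pairwise_orthogonal hsum.hasSum hort).tsum_eq]
    simp only [hnorm]

/-! ### The norm as an even power series, and the Sobolev condition -/

theorem bsNormSq_eq_tsum (hμ : IsWhiteNoise μ) (hν : IsBargmannSegal ν)
    (hw : ∀ n, (f n, w n) ∈ wienerGraph μ n) (hF : HasSum w F) {l : ℝ}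
    (hl : l ∈ Set.Ioo (0 : ℝ) 1) :
    bsNormSq μ ν F l = ∑' n, ‖w n‖ ^ 2 * l ^ (2 * n) := by
  obtain ⟨H, hH, hn⟩ := exists_isBSExtension hμ hν hw hF hl
  rw [bsNormSq, bsExtension_eq hν hH, norm_sq_eq_integral, hn]

/-- By orthogonality the left side is summability of the squared norms, and `nᵐ ≤ (1 + n^{m/2})² ≤ 2
+ 2nᵐ`. The constant term is harmless because `∑ ‖wₙ‖² < ∞`. -/
theorem summable_malliavin_iff (hμ : IsWhiteNoise μ) (hw : ∀ n, (f n, w n) ∈ wienerGraph μ n)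
    (hF : HasSum w F) (m : ℕ) :
    (Summable fun n : ℕ => ((1 + (n : ℝ) ^ ((m : ℝ) / 2) : ℝ) : ℂ) • w n) ↔
      Summable fun n : ℕ => (n : ℝ) ^ m * ‖w n‖ ^ 2 := by
  have hort := pairwise_inner_eq_zero hμ hw
  have hsq := (hasSum_norm_sq_of_pairwise_orthogonal hF hort).summable
  rw [summable_iff_of_pairwise_orthogonal fun i j hij => by
    simp [hort hij]]
  have hpow : ∀ n : ℕ, ((n : ℝ) ^ ((m : ℝ) / 2)) ^ 2 = (n : ℝ) ^ m := fun n => by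
    rw [← Real.rpow_natCast, ← Real.rpow_mul (Nat.cast_nonneg n), ← Real.rpow_natCast]
    congr 1; push_cast; ring
  have hnn : ∀ n : ℕ, 0 ≤ (n : ℝ) ^ ((m : ℝ) / 2) := fun n =>
    Real.rpow_nonneg (Nat.cast_nonneg n) _
  have he : ∀ n : ℕ, ‖((1 + (n : ℝ) ^ ((m : ℝ) / 2) : ℝ) : ℂ) • w n‖ ^ 2 =
      (1 + (n : ℝ) ^ ((m : ℝ) / 2)) ^ 2 * ‖w n‖ ^ 2 := fun n => by
    rw [norm_smul, norm_real, mul_pow, Real.norm_eq_abs, sq_abs]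
  simp only [he]
  constructor
  · refine fun h => Summable.of_nonneg_of_le (fun n => by positivity) (fun n => ?_) h
    rw [← hpow n]
    refine mul_le_mul_of_nonneg_right ?_ (by positivity)
    nlinarith [hnn n]
  · refine fun h => Summable.of_nonneg_of_le (fun n => by positivity) (fun n => ?_)
      ((hsq.mul_left 2).add (h.mul_left 2))
    rw [← hpow n, ← mul_assoc, ← add_mul]
    refine mul_le_mul_of_nonneg_right ?_ (by positivity)
    nlinarith [sq_nonneg (1 - (n : ℝ) ^ ((m : ℝ) / 2))]

theorem mem_Gdual (hμ : IsWhiteNoise μ) (hw : ∀ n, (f n, w n) ∈ wienerGraph μ n)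
    (hF : HasSum w F) : f ∈ Gdual := by
  refine Set.mem_iUnion.mpr ⟨0, fun n => isSymmKernel_of_mem_wienerGraph hμ (hw n), ?_⟩
  have := (hasSum_norm_sq_of_pairwise_orthogonal hF (pairwise_inner_eq_zero hμ hw)).summable
  refine this.congr fun n => ?_
  rw [norm_sq_wienerGraph hμ (hw n)]
  simp

theorem memMalliavinSobolev_iff (hμ : IsWhiteNoise μ) (hν : IsBargmannSegal ν) (F : Lp ℂ 2 μ)
    (m : ℕ) : MemMalliavinSobolev μ (m : ℝ) F ↔
      BddAbove ((fun l : ℝ => iteratedDeriv m (bsNormSq μ ν F) l) '' Set.Ioo (0 : ℝ) 1) := by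
  have key : ∀ (f : KernelSeq) (w : ℕ → Lp ℂ 2 μ), (∀ n, (f n, w n) ∈ wienerGraph μ n) →
      HasSum w F →
      ((Summable fun n : ℕ => ((1 + (n : ℝ) ^ ((m : ℝ) / 2) : ℝ) : ℂ) • w n) ↔
      BddAbove ((fun l : ℝ => iteratedDeriv m (bsNormSq μ ν F) l) '' Set.Ioo (0 : ℝ) 1)) :=
    fun f w hw hF => by
      rw [summable_malliavin_iff hμ hw hF, bddAbove_iteratedDeriv_iff (fun n => by positivity)
        (hasSum_norm_sq_of_pairwise_orthogonal hF (pairwise_inner_eq_zero hμ hw)).summable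
        fun l hl => bsNormSq_eq_tsum hμ hν hw hF hl]
  constructor
  · rintro ⟨f, ⟨-, w, hw, hF⟩, -, w', hw', hs⟩
    -- The Sobolev condition and the chaos expansion come with separate witnesses over the same
    -- kernels. Their difference has kernel zero, hence norm zero.
    have hww : w' = w := funext fun n => by
      have := norm_sq_wienerGraph hμ (Submodule.sub_mem _ (hw' n) (hw n))
      simp only [Prod.mk_sub_mk, sub_self, norm_zero, ne_eq, OfNat.ofNat_ne_zero,
        not_false_eq_true, zero_pow, mul_zero, sq_eq_zero_iff, norm_eq_zero] at this
      exact sub_eq_zero.mp this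
    subst hww
    exact (key f w' hw' hF).mp hs
  · intro hb
    obtain ⟨f, w, hw, hF⟩ := exists_chaosExpansion hμ F
    exact ⟨f, ⟨fun n => isSymmKernel_of_mem_wienerGraph hμ (hw n), w, hw, hF⟩,
      mem_Gdual hμ hw hF, w, hw, (key f w hw hF).mpr hb⟩

end

end WhiteNoise

end

theorem mainTheorem1
    (μ : Measure WhiteNoise.RealTempered) (hμ : WhiteNoise.IsWhiteNoise μ)
    (ν : Measure WhiteNoise.ComplexTempered) (hν : WhiteNoise.IsBargmannSegal ν)
    (F : Lp ℂ 2 μ) (m : ℕ) :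
    (∀ l ∈ Set.Ioo (0 : ℝ) 1, ∃! H : Lp ℂ 2 ν,
      WhiteNoise.IsBSExtension ν (WhiteNoise.scaledS μ F l) H) ∧
    ContDiffOn ℝ ∞ (WhiteNoise.bsNormSq μ ν F) (Set.Ioo 0 1) ∧
    (WhiteNoise.MemMalliavinSobolev μ (m : ℝ) F ↔
      BddAbove ((fun l : ℝ => iteratedDeriv m (WhiteNoise.bsNormSq μ ν F) l) ''
        Set.Ioo (0 : ℝ) 1)) := by
  obtain ⟨f, w, hw, hF⟩ := WhiteNoise.exists_chaosExpansion hμ F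
  have hs := (WhiteNoise.hasSum_norm_sq_of_pairwise_orthogonal hF
    (WhiteNoise.pairwise_inner_eq_zero hμ hw)).summable
  refine ⟨fun l hl => ?_, ?_, WhiteNoise.memMalliavinSobolev_iff hμ hν F m⟩
  · obtain ⟨H, hH, -⟩ := WhiteNoise.exists_isBSExtension hμ hν hw hF hl
    exact ⟨H, hH, fun H' hH' => hH'.unique hν hH⟩
  · refine WhiteNoise.contDiffOn_tsum_even (a := fun n => ‖w n‖ ^ 2) (C := ∑' n, ‖w n‖ ^ 2)
      (fun n => ?_) fun l hl => WhiteNoise.bsNormSq_eq_tsum hμ hν hw hF hl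
    rw [abs_of_nonneg (by positivity)]
    exact hs.le_tsum n fun i _ => by positivity
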